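/- **Theorem (Adaptive Composition of Approximate Typically Stable Algorithms).** *Definitions.* Probability distributions $\mu,\rho$ on the same measurable space are $(\eta,\tau)$-indistinguishable, $\mu\approx_{\eta,\tau}\rho$, if $\mu(O)\le e^{\eta}\rho(O)+\tau$ and $\rho(O)\le e^{\eta}\mu(O)+\tau$ for every measurable $O$. Let $\mathcal P$ be a family of distributions over $\mathcal X^n$. A randomized algorithm $\mathcal A:\mathcal X^n\to\mathcal Z$ is $(\eta,\tau,\nu)$-typically stable with respect to $\mathcal P$ if for every $\mathbf P\in\mathcal P$ there is a distribution $\mathcal W(\mathbf P)$ on $\mathcal Z$ (the output of an oracle that is given $\mathbf P$) such that, with probability at least $1-\nu$ over $\mathbf x\sim\mathbf P$, the output distribution of $\mathcal A(\mathbf x)$ is $(\eta,\tau)$-indistinguishable from $\mathcal W(\mathbf P)$. Let $\mathcal A_i:\mathcal X^n\times\mathcal Z_1\times\dots\times\mathcal Z_{i-1}\to\mathcal Z_i$, $i=1,\dots,k$, be arbitrary randomized algorithms (Markov kernels, the output spaces $\mathcal Z_i$ having countably generated $\sigma$-algebras, for example countable discrete spaces or $\mathbb R^d$) such that for every $i$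 and every fixed prefix $z^{i-1}=(z_1,\dots,z_{i-1})$ the algorithm $\mathcal A_i(\cdot,z^{i-1})$ is $(\eta,\tau,\nu)$-typically stable with respect to $\mathcal P$. Their $k$-fold adaptive composition $\mathcal M^k$ takes $\mathbf x\in\mathcal X^n$, draws successively $z_i=\mathcal A_i(\mathbf x,z^{i-1})$ with fresh randomness for $i=1,\dots,k$, and outputs $(z_1,\dots,z_k)$. The class of $(\eta,\tau,\nu)$-typically stable algorithms w.r.t. $\mathcal P$ *satisfies $(\eta',\tau'',\nu')$-typical stability under $k$-fold adaptive composition* if every such $\mathcal M^k$ is $(\eta',\tau'',\nu')$-typically stable w.r.t. $\mathcal P$. *Statement.* Let $k\ge 2$, $\eta\in(0,3/2]$, $\tau\in(0,\eta/50]$, $\nu\in(0,1)$ and $\tau'\in(0,1)$, and put $$\hat\tau=\frac{2\tau}{1-e^{-\eta}},\qquad \psi(\tau)=\tau(2e^{\eta}+1)+\tau^2\Bigl(1+\frac{2e^{2\eta}}{(e^{\eta}-1)^2}\bigl(4e^{2\eta}+4e^{\eta}-3-2e^{-\eta}+e^{-2\eta}\bigr)\Bigr),$$ $$\eta_j=2\sqrt{2j\log(1/\tau')}\,\eta+j\Bigl(2\eta\Bigl(\frac{e^{2\eta}}{1-\hat\tau}-1\Bigr)+\psi(\tau)\Bigr)\qquad(j\ge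 1).$$ 1. For every family $\mathcal P$ of distributions over $\mathcal X^n$, the class of $(\eta,\tau,\nu)$-typically stable algorithms w.r.t. $\mathcal P$ satisfies $(\eta^*,\tau^*,\nu^*)$-typical stability w.r.t. $\mathcal P$ under $k$-fold adaptive composition, where $$\eta^*=6\sqrt{2k\log(1/\tau')}\,\eta+3k\Bigl(2\eta\Bigl(\frac{e^{2\eta}}{1-\hat\tau}-1\Bigr)+\psi(\tau)\Bigr),\qquad \tau^*=\nu^*=5\Bigl(k\frac{\hat\tau+\tau'}{2\eta}+\frac{\nu}{2\eta}+\sum_{t=1}^{k-1}e^{\eta_t}\frac{\nu}{2\eta}\Bigr)^{1/2}.$$ 2. $\hat\tau=O(\tau/\eta)$ and $\psi(\tau)=O(\tau+\tau^2/\eta^2)$, with absolute constants, over all $\eta\in(0,3/2]$, $\tau\in(0,\eta/50]$. 3. For all $C_1,C_2>0$ there is a constant $C>0$, depending only on $C_1,C_2$, such that whenever in addition $\tau\le C_1\eta^2$ and $\eta\le C_2\sqrt{\log(1/\tau')/k}$, the class satisfies $(\eta^\circ,\tau^\circ,\tau^\circ)$-typical stability w.r.t. $\mathcal P$ under $k$-fold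 adaptive composition, where $$\eta^\circ=C\sqrt{k}\,\eta\sqrt{\log(1/\tau')},\qquad \tau^\circ=C\Bigl(\sqrt{k\bigl(\tau/\eta^2+\tau'/\eta\bigr)}+\sqrt{k\nu/\eta}\;e^{\eta^\circ}\Bigr).$$ -/

import Mathlib

open MeasureTheory ProbabilityTheory

universe u v

noncomputable section

namespace TypicalStability

/-- `(η, τ)`-indistinguishability of two distributions on the same measurable space. -/
def Indist {Z : Type*} [MeasurableSpace Z] (η τ : ℝ) (μ ρ : Measure Z) : Prop :=
  ∀ O : Set Z, MeasurableSet O →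
    μ.real O ≤ Real.exp η * ρ.real O + τ ∧ ρ.real O ≤ Real.exp η * μ.real O + τ

/-- A randomized algorithm on datasets `Fin n → X`, given as a kernel, is `(η, τ, ν)`-typically
stable with respect to the family `Ps` if for every `P ∈ Ps` there is an output distribution `W`
(that of the oracle on input `P`) such that, with probability at least `1 - ν` over `x ∼ P`, the
output distribution of the algorithm on `x` is `(η, τ)`-indistinguishable from `W`. -/
def IsTypicallyStable {X Z : Type*} [MeasurableSpace X] [MeasurableSpace Z] {n : ℕ}
    (Ps : Set (ProbabilityMeasure (Fin n → X))) (η τ ν : ℝ) (A : Kernel (Fin n → X) Z) : Prop :=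
  ∀ P ∈ Ps, ∃ W : ProbabilityMeasure Z, ∃ S : Set (Fin n → X), MeasurableSet S ∧
    1 - ν ≤ (P : Measure (Fin n → X)).real S ∧ ∀ x ∈ S, Indist η τ (A x) (W : Measure Z)

/-- Appending the next output to a prefix `(z₀, …, z_{k-1})` of outputs. -/
def append {Z : ℕ → Type*} (k : ℕ) (p : (∀ j : Fin k, Z j) × Z k) : ∀ j : Fin (k + 1), Z j :=
  Fin.snoc (α := fun j : Fin (k + 1) => Z j) p.1 p.2

theorem measurable_append {Z : ℕ → Type*} [∀ i, MeasurableSpace (Z i)] (k : ℕ) :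
    Measurable (append (Z := Z) k) := by
  refine measurable_pi_lambda _ fun j => ?_
  refine Fin.lastCases ?_ (fun i => ?_) j
  · simpa [append] using measurable_snd
  · simp only [append, Fin.snoc_castSucc]
    exact (measurable_pi_apply i).comp measurable_fst

/-- The `k`-fold adaptive composition mechanism: on input `x`, for `i = 0, …, k - 1` it draws
`z i` from `A i (x, (z 0, …, z (i - 1)))` with fresh randomness, and outputs `(z 0, …, z (k - 1))`.
It only depends on the first `k` algorithms. -/
def composition {D : Type*} [MeasurableSpace D] {Z : ℕ → Type*} [∀ i, MeasurableSpace (Z i)]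
    (A : ∀ i : ℕ, Kernel (D × (∀ j : Fin i, Z j)) (Z i)) :
    (k : ℕ) → Kernel D (∀ j : Fin k, Z j)
  | 0 => Kernel.const D (Measure.dirac fun j => j.elim0)
  | k + 1 => (composition A k ⊗ₖ A k).map (append k)

instance isMarkovKernel_composition {D : Type*} [MeasurableSpace D] {Z : ℕ → Type*}
    [∀ i, MeasurableSpace (Z i)] (A : ∀ i : ℕ, Kernel (D × (∀ j : Fin i, Z j)) (Z i))
    [∀ i, IsMarkovKernel (A i)] (k : ℕ) : IsMarkovKernel (composition A k) := by
  induction k with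
  | zero => unfold composition; infer_instance
  | succ k ih => unfold composition; exact Kernel.IsMarkovKernel.map _ (measurable_append k)

/-- The class of `(η, τ, ν)`-typically stable algorithms w.r.t. `Ps` satisfies
`(η', τ', ν')`-typical stability w.r.t. `Ps` under `k`-fold adaptive composition.  The `i`-th
algorithm sees the dataset and the previous outputs, and is `(η, τ, ν)`-typically stable for
every fixed value of the previous outputs. -/
def StableUnderComposition {X : Type u} [MeasurableSpace X] {n : ℕ}
    (Ps : Set (ProbabilityMeasure (Fin n → X))) (k : ℕ) (η τ ν η' τ' ν' : ℝ) : Prop :=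
  ∀ (Z : ℕ → Type v) [∀ i, MeasurableSpace (Z i)]
    [∀ i, MeasurableSpace.CountablyGenerated (Z i)]
    (A : ∀ i : ℕ, Kernel ((Fin n → X) × (∀ j : Fin i, Z j)) (Z i)) [∀ i, IsMarkovKernel (A i)],
    (∀ i < k, ∀ z : (∀ j : Fin i, Z j), IsTypicallyStable Ps η τ ν ((A i).sectL z)) →
      IsTypicallyStable Ps η' τ' ν' (composition A k)

/-- `τ̂ = 2τ / (1 - e^{-η})`. -/
def tauHat (η τ : ℝ) : ℝ := 2 * τ / (1 - Real.exp (-η))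

/-- The correction term `ψ(τ)` (which also depends on `η`). -/
def psi (η τ : ℝ) : ℝ :=
  τ * (2 * Real.exp η + 1) +
    τ ^ 2 * (1 + 2 * Real.exp (2 * η) / (Real.exp η - 1) ^ 2 *
      (4 * Real.exp (2 * η) + 4 * Real.exp η - 3 - 2 * Real.exp (-η) + Real.exp (-2 * η)))

/-- `η_j`; the argument `τ'` is the free confidence parameter. -/
def etaStep (η τ τ' : ℝ) (j : ℕ) : ℝ :=
  2 * Real.sqrt (2 * j * Real.log (1 / τ')) * η +
    j * (2 * η * (Real.exp (2 * η) / (1 - tauHat η τ) - 1) + psi η τ)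

/-- `η*`. -/
def etaStar (k : ℕ) (η τ τ' : ℝ) : ℝ :=
  6 * Real.sqrt (2 * k * Real.log (1 / τ')) * η +
    3 * k * (2 * η * (Real.exp (2 * η) / (1 - tauHat η τ) - 1) + psi η τ)

/-- `τ* = ν*`. -/
def tauStar (k : ℕ) (η τ ν τ' : ℝ) : ℝ :=
  5 * Real.sqrt (k * ((tauHat η τ + τ') / (2 * η)) + ν / (2 * η) +
    ∑ t ∈ Finset.Icc 1 (k - 1), Real.exp (etaStep η τ τ' t) * (ν / (2 * η)))

end TypicalStability

end

namespace TypicalStability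

open scoped ENNReal NNReal symmDiff

/-! ### Hyperbolic inequalities -/

/-! The oracle distributions in the hypothesis depend on the prefix `z` with no measurability, so
they cannot be chained directly. They are replaced by the averages `meanKernel P (A i)`, which are
kernels and do not see the dataset. For every prefix and every good dataset the `i`-th step is
indistinguishable from this average with parameters `2η` and `d = τ(1 + e^η) + e^η ν`
(`indist_meanKernel`). The oracle of the composition is the chain `B` of the averages.

For a fixed dataset `x`, the chain of the kernels `A i (x, ·)` is compared with `B` by advanced
composition, allowing bad prefixes. Each step is cut down to a subkernel with density `min f (e^ε
g)`, losing mass at most `d` at good prefixes (`exists_truncation`). Convexity of `r ^ (l + 1)`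
bounds its moment of order `l + 1` against the other kernel by `exp (l ((l + 1) ε² / 2 + d))`. In
dual form, by Hölder, this bound multiplies along a chain (`lintegral_chain_le_rpow`), and a choice
of `l` gives the square root in `advEps`. Replacing steps by truncated ones costs `d` plus the
probability of a bad prefix, measured under the truncated chain (`lintegral_chain_le_add_loss`).
That probability is moved to `B` at the price of a factor `exp (advEps i)`, the source of the sum of
`e^{η_t} ν` in `tauStar`.

Since `B` does not depend on `x`, Fubini applies: each prefix is bad for at most a `ν`-fraction of
datasets, so the mean over `x` of the `B`-probability of a bad prefix is at most `ν`. Markov's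
inequality then selects the good datasets (`exists_indist_composition`). The rest is arithmetic:
`tauStar ≥ 1` is trivial, and `tauStar < 1` makes `ν`, `τ`, `τ'` small enough to be absorbed. -/

theorem sinh_le_mul_cosh {x : ℝ} (hx : 0 ≤ x) : Real.sinh x ≤ x * Real.cosh x := by
  have hd : ∀ y : ℝ, HasDerivAt (fun y => y * Real.cosh y - Real.sinh y) (y * Real.sinh y) y := by
    intro y
    have := ((hasDerivAt_id y).mul (Real.hasDerivAt_cosh y)).sub (Real.hasDerivAt_sinh y)
    refine this.congr_deriv ?_
    simp
  have hm : MonotoneOn (fun y => y * Real.cosh y - Real.sinh y) (Set.Ici 0) := by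
    refine monotoneOn_of_deriv_nonneg (convex_Ici 0)
      (fun y _ => (hd y).continuousAt.continuousWithinAt)
      (fun y _ => (hd y).differentiableAt.differentiableWithinAt) fun y hy => ?_
    rw [(hd y).deriv]
    rw [interior_Ici] at hy
    exact mul_nonneg hy.le (Real.sinh_nonneg_iff.2 hy.le)
  have := hm Set.self_mem_Ici hx hx
  simp at this
  linarith

/-- Because `tanh y ≤ y`, the function `cosh y * exp (-y² / 2)` decreases on the nonnegative axis.
This is what yields `ε² / 2` per step in `advEps`. -/
theorem cosh_le_cosh_mul_exp {a b : ℝ} (hb : 0 ≤ b) (hab : b ≤ a) :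
    Real.cosh a ≤ Real.cosh b * Real.exp ((a ^ 2 - b ^ 2) / 2) := by
  have hd : ∀ y : ℝ, HasDerivAt (fun y => Real.cosh y * Real.exp (-(y ^ 2 / 2)))
      ((Real.sinh y - y * Real.cosh y) * Real.exp (-(y ^ 2 / 2))) y := by
    intro y
    have h1 : HasDerivAt (fun y : ℝ => -(y ^ 2 / 2)) (-y) y := by
      have := ((hasDerivAt_pow 2 y).div_const 2).neg
      refine this.congr_deriv ?_
      simp
    refine ((Real.hasDerivAt_cosh y).mul h1.exp).congr_deriv ?_
    ring
  have hm : AntitoneOn (fun y => Real.cosh y * Real.exp (-(y ^ 2 / 2))) (Set.Ici 0) := by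
    refine antitoneOn_of_deriv_nonpos (convex_Ici 0)
      (fun y _ => (hd y).continuousAt.continuousWithinAt)
      (fun y _ => (hd y).differentiableAt.differentiableWithinAt) fun y hy => ?_
    rw [(hd y).deriv]
    rw [interior_Ici] at hy
    exact mul_nonpos_of_nonpos_of_nonneg (by linarith [sinh_le_mul_cosh (le_of_lt hy)])
      (Real.exp_pos _).le
  have h := hm (Set.mem_Ici.2 hb) (Set.mem_Ici.2 (hb.trans hab)) hab
  have h2 := mul_le_mul_of_nonneg_right h (Real.exp_pos (a ^ 2 / 2)).le
  simp only [mul_assoc, ← Real.exp_add] at h2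
  calc Real.cosh a = Real.cosh a * Real.exp (-(a ^ 2 / 2) + a ^ 2 / 2) := by simp
    _ ≤ _ := h2
    _ = _ := by ring_nf

/-- The graph of the convex function `r ^ s` lies below its chord over `[e^{-ε}, e^ε]`; slope and
intercept are quotients of hyperbolic sines. -/
theorem rpow_mul_sinh_add_le {ε s r : ℝ} (hε : 0 < ε) (hs : 1 ≤ s) (h1 : Real.exp (-ε) ≤ r)
    (h2 : r ≤ Real.exp ε) :
    r ^ s * Real.sinh ε + Real.sinh ((s - 1) * ε) ≤ Real.sinh (s * ε) * r := by
  set u := Real.exp (-ε) with hu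
  set v := Real.exp ε with hv
  have huv : u < v := Real.exp_lt_exp.2 (by linarith)
  have hc := (convexOn_rpow hs).2 (Set.mem_Ici.2 (Real.exp_pos (-ε)).le)
    (Set.mem_Ici.2 (Real.exp_pos ε).le)
    (div_nonneg (by linarith : 0 ≤ v - r) (by linarith : 0 ≤ v - u))
    (div_nonneg (by linarith : 0 ≤ r - u) (by linarith : 0 ≤ v - u))
    (by rw [← add_div, div_eq_one_iff_eq (by linarith)]; ring)
  rw [← hu, ← hv] at hc
  have hne : v - u ≠ 0 := by linarith
  have hr : (v - r) / (v - u) * u + (r - u) / (v - u) * v = r := by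
    field_simp; ring
  simp only [smul_eq_mul] at hc
  rw [hr] at hc
  have hc2 := mul_le_mul_of_nonneg_right hc (by linarith : 0 ≤ v - u)
  have hR : ((v - r) / (v - u) * u ^ s + (r - u) / (v - u) * v ^ s) * (v - u)
      = v * u ^ s - u * v ^ s + r * (v ^ s - u ^ s) := by
    field_simp; ring
  rw [hR] at hc2
  have hus : u ^ s = Real.exp (-(s * ε)) := by
    rw [hu, ← Real.exp_mul]; ring_nf
  have hvs : v ^ s = Real.exp (s * ε) := by
    rw [hv, ← Real.exp_mul]; ring_nf
  have e1 : v * u ^ s = Real.exp (-((s - 1) * ε)) := by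
    rw [hus, hv, ← Real.exp_add]; ring_nf
  have e2 : u * v ^ s = Real.exp ((s - 1) * ε) := by
    rw [hvs, hu, ← Real.exp_add]; ring_nf
  rw [e1, e2, hus, hvs] at hc2
  rw [Real.sinh_eq, Real.sinh_eq, Real.sinh_eq]
  linarith

/-- For `d = 0`, sum-to-product turns the left side divided by `sinh ε` into `cosh ((l + 1/2) ε) /
cosh (ε / 2)`. The remaining term is linear in `d` and is absorbed by `1 + l d ≤ exp (l d)`. -/
theorem sinh_sub_sinh_le {ε l d : ℝ} (hε : 0 < ε) (hl : 0 < l) (hd : 0 ≤ d) :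
    Real.sinh ((l + 1) * ε) - Real.sinh (l * ε) * (1 - d) ≤
      Real.sinh ε * Real.exp (l * ((l + 1) * ε ^ 2 / 2 + d)) := by
  have hle : 0 ≤ l * ε := by positivity
  have hs : 0 < Real.sinh ε := Real.sinh_pos_iff.2 hε
  have hK : Real.sinh ((l + 1) * ε) - Real.sinh (l * ε) ≤
      Real.sinh ε * Real.exp (l * (l + 1) * ε ^ 2 / 2) := by
    have e1 : Real.sinh ((l + 1) * ε) - Real.sinh (l * ε) =
        2 * Real.cosh ((l + 1 / 2) * ε) * Real.sinh (ε / 2) := by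
      have a1 : (l + 1) * ε = (l + 1 / 2) * ε + ε / 2 := by ring
      have a2 : l * ε = (l + 1 / 2) * ε - ε / 2 := by ring
      rw [a1, a2, Real.sinh_add, Real.sinh_sub]; ring
    have e2 : Real.sinh ε = 2 * Real.sinh (ε / 2) * Real.cosh (ε / 2) := by
      rw [← Real.sinh_two_mul]; ring_nf
    have e3 := cosh_le_cosh_mul_exp (a := (l + 1 / 2) * ε) (b := ε / 2) (by positivity)
      (by nlinarith)
    have e4 : (((l + 1 / 2) * ε) ^ 2 - (ε / 2) ^ 2) / 2 = l * (l + 1) * ε ^ 2 / 2 := by ring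
    rw [e4] at e3
    rw [e1, e2]
    have : 0 ≤ 2 * Real.sinh (ε / 2) :=
      mul_nonneg zero_le_two (Real.sinh_nonneg_iff.2 (by positivity))
    nlinarith [mul_le_mul_of_nonneg_left e3 this]
  have hS : Real.sinh (l * ε) ≤ Real.sinh ε * (l * Real.exp (l * (l + 1) * ε ^ 2 / 2)) := by
    calc Real.sinh (l * ε) ≤ l * ε * Real.cosh (l * ε) := sinh_le_mul_cosh hle
      _ ≤ l * ε * Real.exp ((l * ε) ^ 2 / 2) :=
        mul_le_mul_of_nonneg_left (Real.cosh_le_exp_half_sq _) hle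
      _ ≤ l * ε * Real.exp (l * (l + 1) * ε ^ 2 / 2) := by
        refine mul_le_mul_of_nonneg_left (Real.exp_le_exp.2 ?_) hle
        nlinarith [mul_pos hl (pow_pos hε 2)]
      _ ≤ l * Real.sinh ε * Real.exp (l * (l + 1) * ε ^ 2 / 2) := by
        refine mul_le_mul_of_nonneg_right ?_ (Real.exp_pos _).le
        exact mul_le_mul_of_nonneg_left (Real.self_le_sinh_iff.2 hε.le) hl.le
      _ = _ := by ring
  have hexp : Real.exp (l * ((l + 1) * ε ^ 2 / 2 + d)) =
      Real.exp (l * (l + 1) * ε ^ 2 / 2) * Real.exp (l * d) := by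
    rw [← Real.exp_add]; ring_nf
  have h1 : 1 + l * d ≤ Real.exp (l * d) := by linarith [Real.add_one_le_exp (l * d)]
  rw [hexp]
  calc Real.sinh ((l + 1) * ε) - Real.sinh (l * ε) * (1 - d)
      = (Real.sinh ((l + 1) * ε) - Real.sinh (l * ε)) + Real.sinh (l * ε) * d := by ring
    _ ≤ Real.sinh ε * Real.exp (l * (l + 1) * ε ^ 2 / 2) +
        Real.sinh ε * (l * Real.exp (l * (l + 1) * ε ^ 2 / 2)) * d :=
      add_le_add hK (mul_le_mul_of_nonneg_right hS hd)
    _ = Real.sinh ε * Real.exp (l * (l + 1) * ε ^ 2 / 2) * (1 + l * d) := by ring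
    _ ≤ Real.sinh ε * Real.exp (l * (l + 1) * ε ^ 2 / 2) * Real.exp (l * d) :=
      mul_le_mul_of_nonneg_left h1 (by positivity)
    _ = _ := by ring

/-! ### Truncated densities -/

/-- Truncating both densities puts their ratio in `[e^{-ε}, e^ε]`, where the chord bound applies.
Passing from the truncated `g` back to `g` only decreases the negative power. -/
theorem trunc_rpow_le {ε l : ℝ} (hε : 0 < ε) (hl : 0 < l) {f g : ℝ} (hf : 0 ≤ f) (hg : 0 ≤ g) :
    (min f (Real.exp ε * g)) ^ (l + 1) * g ^ (-l) * Real.sinh ε +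
      Real.sinh (l * ε) * min g (Real.exp ε * f) ≤
      Real.sinh ((l + 1) * ε) * min f (Real.exp ε * g) := by
  have hE : 0 < Real.exp ε := Real.exp_pos _
  have hE1 : 1 ≤ Real.exp ε := Real.one_le_exp hε.le
  rcases hg.eq_or_lt with rfl | hg
  · simp [Real.zero_rpow (by linarith : l + 1 ≠ 0), hf, mul_nonneg hE.le hf]
  rcases hf.eq_or_lt with rfl | hf
  · simp [Real.zero_rpow (by linarith : l + 1 ≠ 0), hg.le, mul_nonneg hE.le hg.le]
  set f' := min f (Real.exp ε * g) with hf'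
  set g' := min g (Real.exp ε * f) with hg'
  have pf : 0 < f' := lt_min hf (by positivity)
  have pg : 0 < g' := lt_min hg (by positivity)
  have b1 : Real.exp (-ε) ≤ f' / g' := by
    rw [le_div_iff₀ pg, Real.exp_neg, inv_mul_le_iff₀ hE]
    refine le_trans ?_ (le_of_eq (mul_min_of_nonneg _ _ hE.le).symm)
    refine le_min (min_le_right _ _) ((min_le_left _ _).trans ?_)
    nlinarith [mul_le_mul hE1 hE1 zero_le_one hE.le]
  have b2 : f' / g' ≤ Real.exp ε := by
    rw [div_le_iff₀ pg]
    refine le_trans ?_ (le_of_eq (mul_min_of_nonneg _ _ hE.le).symm)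
    refine le_min (min_le_right _ _) ((min_le_left _ _).trans ?_)
    nlinarith [mul_le_mul hE1 hE1 zero_le_one hE.le]
  have hc := rpow_mul_sinh_add_le hε (by linarith : 1 ≤ l + 1) b1 b2
  have hc2 := mul_le_mul_of_nonneg_right hc pg.le
  have h3 : f' ^ (l + 1) * g ^ (-l) ≤ (f' / g') ^ (l + 1) * g' := by
    have : (f' / g') ^ (l + 1) * g' = f' ^ (l + 1) * g' ^ (-l) := by
      rw [Real.div_rpow pf.le pg.le, Real.rpow_add pg, Real.rpow_one, Real.rpow_neg pg.le]
      field_simp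
    rw [this]
    refine mul_le_mul_of_nonneg_left ?_ (by positivity)
    exact Real.rpow_le_rpow_of_nonpos pg (min_le_left _ _) (by linarith)
  have hs : 0 < Real.sinh ε := Real.sinh_pos_iff.2 hε
  have h4 := mul_le_mul_of_nonneg_right h3 hs.le
  have h5 : Real.sinh ((l + 1) * ε) * (f' / g') * g' = Real.sinh ((l + 1) * ε) * f' := by
    field_simp
  rw [h5] at hc2
  simp only [add_sub_cancel_right] at hc2
  linarith

/-- Integrate the pointwise chord bound: the truncated `f` has mass at most `1`, the truncated `g`
at least `1 - d`, and `sinh_sub_sinh_le` handles what remains. -/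
theorem lintegral_trunc_rpow_le {Z : Type*} [MeasurableSpace Z] (κ : Measure Z) {f g : Z → ℝ≥0}
    (hf : Measurable f) (hg : Measurable g) {ε l d : ℝ} (hε : 0 < ε) (hl : 0 < l) (hd : 0 ≤ d)
    (hf1 : ∫⁻ y, f y ∂κ ≤ 1)
    (hgd : 1 ≤ ∫⁻ y, (min (g y) (Real.toNNReal (Real.exp ε) * f y) : ℝ≥0) ∂κ + ENNReal.ofReal d) :
    ∫⁻ y, ((min (f y) (Real.toNNReal (Real.exp ε) * g y)) ^ (l + 1) * (g y) ^ (-l) : ℝ≥0) ∂κ ≤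
      ENNReal.ofReal (Real.exp (l * ((l + 1) * ε ^ 2 / 2 + d))) := by
  set E := Real.toNNReal (Real.exp ε) with hE
  have hEc : (E : ℝ) = Real.exp ε := Real.coe_toNNReal _ (Real.exp_pos _).le
  have hs : 0 < Real.sinh ε := Real.sinh_pos_iff.2 hε
  have hsl : 0 ≤ Real.sinh (l * ε) := Real.sinh_nonneg_iff.2 (by positivity)
  have hsl1 : 0 ≤ Real.sinh ((l + 1) * ε) := Real.sinh_nonneg_iff.2 (by positivity)
  have key : ∀ y, ENNReal.ofReal (Real.sinh ε) *
        (((min (f y) (E * g y)) ^ (l + 1) * (g y) ^ (-l) : ℝ≥0) : ℝ≥0∞) +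
      ENNReal.ofReal (Real.sinh (l * ε)) * ((min (g y) (E * f y) : ℝ≥0) : ℝ≥0∞) ≤
      ENNReal.ofReal (Real.sinh ((l + 1) * ε)) * (f y : ℝ≥0∞) := by
    intro y
    have h := trunc_rpow_le hε hl (f y).coe_nonneg (g y).coe_nonneg
    have h' : Real.sinh ((l + 1) * ε) * min (f y : ℝ) (Real.exp ε * g y) ≤
      Real.sinh ((l + 1) * ε) * f y := mul_le_mul_of_nonneg_left (min_le_left _ _) hsl1
    rw [ENNReal.ofReal, ENNReal.ofReal, ENNReal.ofReal]
    norm_cast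
    rw [← NNReal.coe_le_coe]
    push_cast
    rw [Real.coe_toNNReal _ hs.le, Real.coe_toNNReal _ hsl, Real.coe_toNNReal _ hsl1, hEc]
    linarith
  have h := lintegral_mono (μ := κ) key
  have m1 : Measurable fun y => (((min (f y) (E * g y)) ^ (l + 1) * (g y) ^ (-l) : ℝ≥0) : ℝ≥0∞) :=
    (((hf.min (hg.const_mul E)).pow_const _).mul (hg.pow_const _)).coe_nnreal_ennreal
  have m2 : Measurable fun y => ((min (g y) (E * f y) : ℝ≥0) : ℝ≥0∞) :=
    (hg.min (hf.const_mul E)).coe_nnreal_ennreal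
  rw [lintegral_add_left (m1.const_mul _), lintegral_const_mul _ m1, lintegral_const_mul _ m2,
    lintegral_const_mul _ hf.coe_nnreal_ennreal] at h
  set I := ∫⁻ y, ((min (f y) (E * g y)) ^ (l + 1) * (g y) ^ (-l) : ℝ≥0) ∂κ
  set J := ∫⁻ y, (min (g y) (E * f y) : ℝ≥0) ∂κ
  have hle : ENNReal.ofReal (Real.sinh ε) * I + ENNReal.ofReal (Real.sinh (l * ε)) * J ≤
      ENNReal.ofReal (Real.sinh ((l + 1) * ε)) :=
    h.trans (mul_le_of_le_one_right' hf1)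
  have hIne : I ≠ ∞ := by
    intro hI
    rw [hI, ENNReal.mul_top (by simpa using hs)] at hle
    simp at hle
  have hJne : J ≠ ∞ := by
    have : J ≤ ∫⁻ y, (E : ℝ≥0∞) * f y ∂κ := by
      refine lintegral_mono fun y => ?_
      rw [← ENNReal.coe_mul]
      exact ENNReal.coe_le_coe.2 (min_le_right _ _)
    rw [lintegral_const_mul _ hf.coe_nnreal_ennreal] at this
    exact ne_top_of_le_ne_top ENNReal.coe_ne_top (this.trans (mul_le_of_le_one_right' hf1))
  rw [← ENNReal.ofReal_toReal hIne, ← ENNReal.ofReal_toReal hJne,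
    ← ENNReal.ofReal_mul hs.le, ← ENNReal.ofReal_mul hsl,
    ← ENNReal.ofReal_add (by positivity) (by positivity), ENNReal.ofReal_le_ofReal_iff hsl1] at hle
  rw [← ENNReal.ofReal_toReal hJne, ← ENNReal.ofReal_one,
    ← ENNReal.ofReal_add (by positivity) (by positivity),
    ENNReal.ofReal_le_ofReal_iff (by positivity)] at hgd
  rw [← ENNReal.ofReal_toReal hIne]
  refine ENNReal.ofReal_le_ofReal ?_
  have h6 := sinh_sub_sinh_le hε hl hd
  have h7 : Real.sinh (l * ε) * (1 - d) ≤ Real.sinh (l * ε) * J.toReal :=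
    mul_le_mul_of_nonneg_left (by linarith) hsl
  exact le_of_mul_le_mul_left (by linarith) hs

/-- Dual form of the moment bound, by Hölder with exponents `l + 1` and `(l + 1) / l`. Unlike a
bound on densities, it can be iterated along kernels. -/
theorem lintegral_mul_trunc_le {Z : Type*} [MeasurableSpace Z] (κ : Measure Z) {f g : Z → ℝ≥0}
    (hf : Measurable f) (hg : Measurable g) {ε l d : ℝ} (hε : 0 < ε) (hl : 0 < l) (hd : 0 ≤ d)
    (hf1 : ∫⁻ y, f y ∂κ ≤ 1)
    (hgd : 1 ≤ ∫⁻ y, (min (g y) (Real.toNNReal (Real.exp ε) * f y) : ℝ≥0) ∂κ + ENNReal.ofReal d)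
    {h : Z → ℝ≥0∞} (hh : Measurable h) :
    ∫⁻ y, (min (f y) (Real.toNNReal (Real.exp ε) * g y) : ℝ≥0) * h y ∂κ ≤
      ENNReal.ofReal (Real.exp (l * ((l + 1) * ε ^ 2 / 2 + d) / (l + 1))) *
        (∫⁻ y, g y * h y ^ ((l + 1) / l) ∂κ) ^ (l / (l + 1)) := by
  set E := Real.toNNReal (Real.exp ε) with hE
  have hl1 : 0 < l + 1 := by linarith
  have hpq : (l + 1).HolderConjugate ((l + 1) / l) := by
    rw [Real.holderConjugate_iff]
    refine ⟨by linarith, ?_⟩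
    field_simp
    ring
  set F : Z → ℝ≥0∞ := fun y => ((min (f y) (E * g y) * g y ^ (-(l / (l + 1))) : ℝ≥0) : ℝ≥0∞)
  set H : Z → ℝ≥0∞ := fun y => ((g y ^ (l / (l + 1)) : ℝ≥0) : ℝ≥0∞) * h y
  have mF : Measurable F :=
    ((hf.min (hg.const_mul E)).mul (hg.pow_const _)).coe_nnreal_ennreal
  have mH : Measurable H := (hg.pow_const _).coe_nnreal_ennreal.mul hh
  have h1 : ∀ y, ((min (f y) (E * g y) : ℝ≥0) : ℝ≥0∞) * h y = (F * H) y := by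
    intro y
    simp only [F, H, Pi.mul_apply]
    rw [← mul_assoc, ← ENNReal.coe_mul]
    congr 2
    -- Where `g` vanishes, so does the truncated `f`, hence splitting off a negative power of `g`
    -- loses nothing.
    rcases eq_or_ne (g y) 0 with h0 | h0
    · simp [h0]
    · rw [mul_assoc, ← NNReal.rpow_add h0]; simp
  have h2 : ∀ y, F y ^ (l + 1) =
      (((min (f y) (E * g y)) ^ (l + 1) * (g y) ^ (-l) : ℝ≥0) : ℝ≥0∞) := by
    intro y
    simp only [F]
    rw [← ENNReal.coe_rpow_of_nonneg _ hl1.le, NNReal.mul_rpow, ← NNReal.rpow_mul]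
    congr 3
    field_simp
  have h3 : ∀ y, H y ^ ((l + 1) / l) = g y * h y ^ ((l + 1) / l) := by
    intro y
    simp only [H]
    rw [ENNReal.mul_rpow_of_nonneg _ _ (by positivity),
      ← ENNReal.coe_rpow_of_nonneg _ (by positivity), ← NNReal.rpow_mul]
    congr 3
    rw [div_mul_div_cancel₀ hl1.ne', div_self hl.ne', NNReal.rpow_one]
  simp_rw [h1]
  refine (ENNReal.lintegral_mul_le_Lp_mul_Lq κ hpq mF.aemeasurable mH.aemeasurable).trans ?_
  simp_rw [h2, h3]
  have h4 := lintegral_trunc_rpow_le κ hf hg hε hl hd hf1 hgd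
  rw [one_div_div]
  refine mul_le_mul_left ?_ _
  refine (ENNReal.rpow_le_rpow h4 (by positivity)).trans (le_of_eq ?_)
  rw [ENNReal.ofReal_rpow_of_pos (Real.exp_pos _), ← Real.exp_mul, mul_one_div]

/-- The mass lost by truncation sits on the set where `g` exceeds `E * f`; the hypothesis on that
one set bounds it by `d`. -/
theorem one_le_lintegral_min_add {Z : Type*} [MeasurableSpace Z] (κ : Measure Z) {f g : Z → ℝ≥0}
    (hf : Measurable f) (hg : Measurable g) (E : ℝ≥0) {d : ℝ≥0∞}
    (hg1 : ∫⁻ y, g y ∂κ = 1)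
    (h : ∀ O, MeasurableSet O → ∫⁻ y in O, g y ∂κ ≤ E * ∫⁻ y in O, f y ∂κ + d) :
    1 ≤ ∫⁻ y, (min (g y) (E * f y) : ℝ≥0) ∂κ + d := by
  set O := {y | E * f y < g y}
  have hO : MeasurableSet O := measurableSet_lt (hf.const_mul E) hg
  rw [← hg1, ← lintegral_add_compl _ hO, ← lintegral_add_compl (fun y => ((min (g y) _ : ℝ≥0) : ℝ≥0∞)) hO]
  have e1 : ∫⁻ y in O, ((min (g y) (E * f y) : ℝ≥0) : ℝ≥0∞) ∂κ = E * ∫⁻ y in O, f y ∂κ := by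
    rw [← lintegral_const_mul _ hf.coe_nnreal_ennreal]
    refine setLIntegral_congr_fun hO fun y hy => ?_
    rw [← ENNReal.coe_mul, min_eq_right (le_of_lt hy)]
  have e2 : ∫⁻ y in Oᶜ, ((min (g y) (E * f y) : ℝ≥0) : ℝ≥0∞) ∂κ = ∫⁻ y in Oᶜ, g y ∂κ := by
    refine setLIntegral_congr_fun hO.compl fun y hy => ?_
    have hy : ¬ E * f y < g y := hy
    rw [min_eq_left (not_lt.1 hy)]
  rw [e1, e2, add_right_comm]
  exact add_le_add_left (h O hO) _

theorem Indist.symm {Z : Type*} [MeasurableSpace Z] {η τ : ℝ} {μ ρ : Measure Z}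
    (h : Indist η τ μ ρ) : Indist η τ ρ μ := fun O hO => ⟨(h O hO).2, (h O hO).1⟩

theorem Indist.measure_le {Z : Type*} [MeasurableSpace Z] {η τ : ℝ} {μ ρ : Measure Z}
    [IsFiniteMeasure μ] [IsFiniteMeasure ρ] (hτ : 0 ≤ τ)
    (h : Indist η τ μ ρ) {O : Set Z} (hO : MeasurableSet O) :
    μ O ≤ ENNReal.ofReal (Real.exp η) * ρ O + ENNReal.ofReal τ := by
  rw [← ofReal_measureReal (μ := μ), ← ofReal_measureReal (μ := ρ),
    ← ENNReal.ofReal_mul (Real.exp_pos _).le,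
    ← ENNReal.ofReal_add (mul_nonneg (Real.exp_pos _).le measureReal_nonneg) hτ]
  exact ENNReal.ofReal_le_ofReal (h O hO).1

/-- Where two kernels are `(ε, d)`-indistinguishable, the first one can be truncated to a
subkernel of nearly full mass with a Rényi-type bound with respect to the second one. -/
theorem exists_truncation {Y Z : Type*} [MeasurableSpace Y] [MeasurableSpace Z]
    [MeasurableSpace.CountablyGenerated Z] (a b : Kernel Y Z) [IsMarkovKernel a]
    [IsMarkovKernel b] {ε d : ℝ} (hε : 0 < ε) (hd : 0 ≤ d) {G : Set Y} (hG : MeasurableSet G)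
    (hab : ∀ z ∈ G, Indist ε d (a z) (b z)) :
    ∃ a' : Kernel Y Z, IsFiniteKernel a' ∧ (∀ z, a' z ≤ a z) ∧
      (∀ z, ∀ l : ℝ, 0 < l → ∀ h : Z → ℝ≥0∞, Measurable h → ∫⁻ y, h y ∂(a' z) ≤
        ENNReal.ofReal (Real.exp (l * ((l + 1) * ε ^ 2 / 2 + d) / (l + 1))) *
          (∫⁻ y, h y ^ ((l + 1) / l) ∂(b z)) ^ (l / (l + 1))) ∧
      (∀ z ∈ G, ∀ h : Z → ℝ≥0∞, Measurable h → (∀ y, h y ≤ 1) →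
        ∫⁻ y, h y ∂(a z) ≤ ∫⁻ y, h y ∂(a' z) + ENNReal.ofReal d) := by
  classical
  set E := Real.toNNReal (Real.exp ε) with hE
  set f : Y → Z → ℝ≥0 := fun z y => Real.toNNReal (Kernel.rnDerivAux a (a + b) z y) with hf
  set g : Y → Z → ℝ≥0 := fun z y => Real.toNNReal (1 - Kernel.rnDerivAux a (a + b) z y) with hg
  have mf : Measurable (Function.uncurry f) := (Kernel.measurable_rnDerivAux a (a + b)).real_toNNReal
  have mg : Measurable (Function.uncurry g) :=
    (measurable_const.sub (Kernel.measurable_rnDerivAux a (a + b))).real_toNNReal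
  have mfz : ∀ z, Measurable (f z) := fun z => mf.of_uncurry_left
  have mgz : ∀ z, Measurable (g z) := fun z => mg.of_uncurry_left
  have ha : ∀ z, a z = ((a + b) z).withDensity (fun y => f z y) := fun z => by
    rw [← Kernel.withDensity_apply (f := fun z y => (f z y : ℝ≥0∞)) _ mf.coe_nnreal_ennreal]
    conv_lhs => rw [← Kernel.withDensity_rnDerivAux a b]
  have hb : ∀ z, b z = ((a + b) z).withDensity (fun y => g z y) := fun z => by
    rw [← Kernel.withDensity_apply (f := fun z y => (g z y : ℝ≥0∞)) _ mg.coe_nnreal_ennreal]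
    conv_lhs => rw [← Kernel.withDensity_one_sub_rnDerivAux a b]
  have la : ∀ z (h : Z → ℝ≥0∞), Measurable h →
      ∫⁻ y, h y ∂(a z) = ∫⁻ y, f z y * h y ∂((a + b) z) := fun z h hh => by
    conv_lhs => rw [ha z]
    rw [lintegral_withDensity_eq_lintegral_mul _ (mfz z).coe_nnreal_ennreal hh]; rfl
  have lb : ∀ z (h : Z → ℝ≥0∞), Measurable h →
      ∫⁻ y, h y ∂(b z) = ∫⁻ y, g z y * h y ∂((a + b) z) := fun z h hh => by
    conv_lhs => rw [hb z]
    rw [lintegral_withDensity_eq_lintegral_mul _ (mgz z).coe_nnreal_ennreal hh]; rfl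
  have sa : ∀ z O, MeasurableSet O → ∫⁻ y in O, f z y ∂((a + b) z) = a z O := fun z O hO => by
    conv_rhs => rw [ha z]
    rw [withDensity_apply _ hO]
  have sb : ∀ z O, MeasurableSet O → ∫⁻ y in O, g z y ∂((a + b) z) = b z O := fun z O hO => by
    conv_rhs => rw [hb z]
    rw [withDensity_apply _ hO]
  have f1 : ∀ z, ∫⁻ y, f z y ∂((a + b) z) = 1 := fun z => by
    rw [← setLIntegral_univ, sa z _ MeasurableSet.univ, measure_univ]
  have g1 : ∀ z, ∫⁻ y, g z y ∂((a + b) z) = 1 := fun z => by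
    rw [← setLIntegral_univ, sb z _ MeasurableSet.univ, measure_univ]
  -- Off `G` the subkernel is zero, so the moment bound holds at every prefix and not only at the
  -- good ones.
  set D : Y → Z → ℝ≥0 := fun z y => if z ∈ G then min (f z y) (E * g z y) else 0 with hD
  have mD : Measurable (Function.uncurry D) :=
    Measurable.ite (measurable_fst hG) (mf.min (mg.const_mul E)) measurable_const
  set a' := Kernel.withDensity (a + b) (fun z y => (D z y : ℝ≥0∞)) with ha'
  have la' : ∀ z (h : Z → ℝ≥0∞), Measurable h →
      ∫⁻ y, h y ∂(a' z) = ∫⁻ y, D z y * h y ∂((a + b) z) := fun z h hh => by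
    rw [ha', Kernel.lintegral_withDensity _ mD.coe_nnreal_ennreal _ hh]
  have Dle : ∀ z y, D z y ≤ f z y := fun z y => by
    simp only [hD]
    split_ifs
    · exact min_le_left _ _
    · exact zero_le
  have hEg : ∀ z ∈ G, 1 ≤ ∫⁻ y, (min (g z y) (E * f z y) : ℝ≥0) ∂((a + b) z) + ENNReal.ofReal d :=
    fun z hz => one_le_lintegral_min_add _ (mfz z) (mgz z) E (g1 z) fun O hO => by
      rw [sa z O hO, sb z O hO]
      exact (hab z hz).symm.measure_le hd hO
  have hEf : ∀ z ∈ G, 1 ≤ ∫⁻ y, (min (f z y) (E * g z y) : ℝ≥0) ∂((a + b) z) + ENNReal.ofReal d :=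
    fun z hz => one_le_lintegral_min_add _ (mgz z) (mfz z) E (f1 z) fun O hO => by
      rw [sa z O hO, sb z O hO]
      exact (hab z hz).measure_le hd hO
  have a'le : ∀ z, a' z ≤ a z := by
    intro z
    rw [ha', Kernel.withDensity_apply _ mD.coe_nnreal_ennreal]
    conv_rhs => rw [ha z]
    exact withDensity_mono (Filter.Eventually.of_forall fun y => ENNReal.coe_le_coe.2 (Dle z y))
  refine ⟨a', ⟨⟨1, ENNReal.one_lt_top, fun z => (a'le z _).trans prob_le_one⟩⟩, a'le, ?_, ?_⟩
  · intro z l hl h hh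
    by_cases hz : z ∈ G
    · rw [la' z h hh, lb z _ (hh.pow_const _)]
      simp only [hD, hz, if_true]
      exact lintegral_mul_trunc_le _ (mfz z) (mgz z) hε hl hd (f1 z).le (hEg z hz) hh
    · rw [la' z h hh]
      simp [hD, hz]
  · intro z hz h hh h1
    rw [la z h hh, la' z h hh]
    have hDz : ∀ y, D z y = min (f z y) (E * g z y) := fun y => by simp [hD, hz]
    have hsplit : ∀ y, (f z y : ℝ≥0∞) * h y ≤ D z y * h y + ((f z y - D z y : ℝ≥0) : ℝ≥0∞) := by
      intro y
      have : (f z y : ℝ≥0∞) = D z y + ((f z y - D z y : ℝ≥0) : ℝ≥0∞) := by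
        rw [← ENNReal.coe_add, add_tsub_cancel_of_le (Dle z y)]
      conv_lhs => rw [this]
      rw [add_mul]
      exact add_le_add_right (mul_le_of_le_one_right' (h1 y)) _
    have mDz : Measurable (D z) := mD.of_uncurry_left
    refine (lintegral_mono hsplit).trans ?_
    have mDh : Measurable fun y => (D z y : ℝ≥0∞) * h y := mDz.coe_nnreal_ennreal.mul hh
    rw [lintegral_add_left mDh]
    refine add_le_add_right ?_ _
    have hfin : ∫⁻ y, D z y ∂((a + b) z) ≠ ∞ :=
      ne_top_of_le_ne_top ENNReal.one_ne_top
        ((lintegral_mono fun y => ENNReal.coe_le_coe.2 (Dle z y)).trans (f1 z).le)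
    have htot : ∫⁻ y, D z y ∂((a + b) z) + ∫⁻ y, ((f z y - D z y : ℝ≥0) : ℝ≥0∞) ∂((a + b) z) = 1 := by
      rw [← lintegral_add_left mDz.coe_nnreal_ennreal, ← f1 z]
      refine lintegral_congr fun y => ?_
      rw [← ENNReal.coe_add, add_tsub_cancel_of_le (Dle z y)]
    have h2 := hEf z hz
    simp_rw [← hDz] at h2
    rw [← htot] at h2
    exact (ENNReal.add_le_add_iff_left hfin).1 h2

/-! ### Measurability of the event that two kernels are indistinguishable -/

theorem indist_of_isSetAlgebra {Z : Type*} [mZ : MeasurableSpace Z] {𝒜 : Set (Set Z)}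
    (h𝒜 : IsSetAlgebra 𝒜) (hgen : mZ = MeasurableSpace.generateFrom 𝒜) {η τ : ℝ}
    {μ ρ : Measure Z} [IsFiniteMeasure μ] [IsFiniteMeasure ρ]
    (h : ∀ s ∈ 𝒜, μ.real s ≤ Real.exp η * ρ.real s + τ ∧ ρ.real s ≤ Real.exp η * μ.real s + τ) :
    Indist η τ μ ρ := by
  have hdense := Measure.MeasureDense.of_generateFrom_isSetAlgebra_finite (μ := μ + ρ) h𝒜 hgen
  have hsub : ∀ (m : Measure Z) [IsFiniteMeasure m] (s t : Set Z),
      m.real s ≤ m.real t + m.real (s ∆ t) := by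
    intro m _ s t
    refine (measureReal_mono (s₂ := t ∪ (s ∆ t)) ?_).trans (measureReal_union_le _ _)
    intro x hx
    by_cases hxt : x ∈ t
    · exact Or.inl hxt
    · exact Or.inr (Or.inl ⟨hx, hxt⟩)
  intro O hO
  have main : ∀ ε > 0, μ.real O ≤ Real.exp η * ρ.real O + τ + (1 + Real.exp η) * ε ∧
      ρ.real O ≤ Real.exp η * μ.real O + τ + (1 + Real.exp η) * ε := by
    intro ε hε
    obtain ⟨t, ht, htε⟩ := hdense.approx O hO (measure_ne_top _ _) ε hε
    have h1 : μ.real (O ∆ t) + ρ.real (O ∆ t) < ε := by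
      rw [← measureReal_add_apply]
      exact (ENNReal.lt_ofReal_iff_toReal_lt (measure_ne_top _ _)).1 htε
    have h2 : 0 ≤ μ.real (O ∆ t) := measureReal_nonneg
    have h3 : 0 ≤ ρ.real (O ∆ t) := measureReal_nonneg
    have a1 := hsub μ O t
    have a2 := hsub ρ O t
    have a3 := hsub μ t O
    have a4 := hsub ρ t O
    rw [symmDiff_comm] at a3 a4
    have hE := Real.exp_pos η
    obtain ⟨b1, b2⟩ := h t ht
    constructor
    · nlinarith [mul_le_mul_of_nonneg_left (a4.trans (by linarith : _ ≤ ρ.real O + ε)) hE.le]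
    · nlinarith [mul_le_mul_of_nonneg_left (a3.trans (by linarith : _ ≤ μ.real O + ε)) hE.le]
  have hE : 0 < 1 + Real.exp η := by positivity
  constructor
  · refine le_of_forall_pos_le_add fun ε hε => ?_
    have := (main (ε / (1 + Real.exp η)) (by positivity)).1
    rwa [mul_div_cancel₀ _ hE.ne'] at this
  · refine le_of_forall_pos_le_add fun ε hε => ?_
    have := (main (ε / (1 + Real.exp η)) (by positivity)).2
    rwa [mul_div_cancel₀ _ hE.ne'] at this

/-- A countably generated σ-algebra has a countable generating algebra, and testing on that algebra
suffices by approximation in measure. The event is thus a countable intersection. -/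
theorem measurableSet_indist {Y Z : Type*} [MeasurableSpace Y] [mZ : MeasurableSpace Z]
    [MeasurableSpace.CountablyGenerated Z] (a b : Kernel Y Z) [IsFiniteKernel a]
    [IsFiniteKernel b] (η τ : ℝ) : MeasurableSet {y | Indist η τ (a y) (b y)} := by
  set 𝒜 := generateSetAlgebra (MeasurableSpace.countableGeneratingSet Z) with h𝒜
  have hc : 𝒜.Countable :=
    countable_generateSetAlgebra MeasurableSpace.countable_countableGeneratingSet
  have hgen : mZ = MeasurableSpace.generateFrom 𝒜 := by
    rw [h𝒜, generateFrom_generateSetAlgebra_eq,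
      MeasurableSpace.generateFrom_countableGeneratingSet]
  have hms : ∀ s ∈ 𝒜, MeasurableSet s := fun s hs => by
    rw [hgen]; exact MeasurableSpace.measurableSet_generateFrom hs
  have heq : {y | Indist η τ (a y) (b y)} = ⋂ s ∈ 𝒜,
      {y | (a y).real s ≤ Real.exp η * (b y).real s + τ ∧
        (b y).real s ≤ Real.exp η * (a y).real s + τ} := by
    ext y
    simp only [Set.mem_ofPred_eq, Set.mem_iInter]
    exact ⟨fun h s hs => h s (hms s hs),
      fun h => indist_of_isSetAlgebra isSetAlgebra_generateSetAlgebra hgen h⟩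
  rw [heq]
  refine MeasurableSet.biInter hc fun s hs => ?_
  have ma : Measurable fun y => (a y).real s := (a.measurable_coe (hms s hs)).ennreal_toReal
  have mb : Measurable fun y => (b y).real s := (b.measurable_coe (hms s hs)).ennreal_toReal
  exact (measurableSet_le ma ((mb.const_mul _).add_const _)).inter
    (measurableSet_le mb ((ma.const_mul _).add_const _))

/-! ### Chains of kernels -/

/-- The law of the sequence of outputs when the `i`-th output is drawn from `a i` applied to the
previous outputs. -/
noncomputable def chain {Z : ℕ → Type*} [∀ i, MeasurableSpace (Z i)]
    (a : ∀ i : ℕ, Kernel (∀ j : Fin i, Z j) (Z i)) : (k : ℕ) → Measure (∀ j : Fin k, Z j)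
  | 0 => Measure.dirac fun j => j.elim0
  | k + 1 => (chain a k ⊗ₘ a k).map (append k)

section chain

variable {Z : ℕ → Type*} [∀ i, MeasurableSpace (Z i)]

instance isFiniteMeasure_chain (a : ∀ i : ℕ, Kernel (∀ j : Fin i, Z j) (Z i))
    [∀ i, IsFiniteKernel (a i)] (k : ℕ) : IsFiniteMeasure (chain a k) := by
  induction k with
  | zero => unfold chain; infer_instance
  | succ k ih => unfold chain; infer_instance

instance isProbabilityMeasure_chain (a : ∀ i : ℕ, Kernel (∀ j : Fin i, Z j) (Z i))
    [∀ i, IsMarkovKernel (a i)] (k : ℕ) : IsProbabilityMeasure (chain a k) := by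
  induction k with
  | zero => unfold chain; infer_instance
  | succ k ih =>
    unfold chain
    exact Measure.isProbabilityMeasure_map (measurable_append k).aemeasurable

theorem lintegral_chain_succ (a : ∀ i : ℕ, Kernel (∀ j : Fin i, Z j) (Z i))
    [∀ i, IsFiniteKernel (a i)] (k : ℕ) {h : (∀ j : Fin (k + 1), Z j) → ℝ≥0∞}
    (hh : Measurable h) :
    ∫⁻ z, h z ∂(chain a (k + 1)) = ∫⁻ z, ∫⁻ y, h (append k (z, y)) ∂(a k z) ∂(chain a k) := by
  rw [chain, lintegral_map hh (measurable_append k),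
    Measure.lintegral_compProd (f := fun p => h (append k p)) (hh.comp (measurable_append k))]

theorem composition_apply {D : Type*} [MeasurableSpace D]
    (A : ∀ i : ℕ, Kernel (D × (∀ j : Fin i, Z j)) (Z i)) [∀ i, IsMarkovKernel (A i)] (k : ℕ)
    (x : D) : composition A k x = chain (fun i => (A i).sectR x) k := by
  induction k with
  | zero => simp [composition, chain]
  | succ k ih =>
    rw [composition, chain, Kernel.map_apply _ (measurable_append k),
      Kernel.compProd_apply_eq_compProd_sectR, ih]

theorem measurable_lintegral_append {k : ℕ} (a : Kernel (∀ j : Fin k, Z j) (Z k))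
    [IsFiniteKernel a] {h : (∀ j : Fin (k + 1), Z j) → ℝ≥0∞} (hh : Measurable h) :
    Measurable fun z => ∫⁻ y, h (append k (z, y)) ∂(a z) :=
  Measurable.lintegral_kernel_prod_right' (hh.comp (measurable_append k))

theorem measurable_append_right {k : ℕ} (z : ∀ j : Fin k, Z j) :
    Measurable fun y => append (Z := Z) k (z, y) :=
  (measurable_append k).comp measurable_prodMk_left

/-! ### Comparing two chains step by step -/

theorem chain_mono {a a' : ∀ i : ℕ, Kernel (∀ j : Fin i, Z j) (Z i)} [∀ i, IsFiniteKernel (a i)]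
    [∀ i, IsFiniteKernel (a' i)] (h : ∀ i z, a' i z ≤ a i z) (k : ℕ) :
    chain a' k ≤ chain a k := by
  induction k with
  | zero => exact le_rfl
  | succ k ih =>
    refine Measure.le_iff.2 fun s hs => ?_
    rw [← lintegral_indicator_one hs, ← lintegral_indicator_one hs,
      lintegral_chain_succ a' k (measurable_one.indicator hs),
      lintegral_chain_succ a k (measurable_one.indicator hs)]
    exact lintegral_mono' ih fun z => lintegral_mono' (h k z) le_rfl

theorem lintegral_chain_le_rpow {a' b : ∀ i : ℕ, Kernel (∀ j : Fin i, Z j) (Z i)}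
    [∀ i, IsFiniteKernel (a' i)] [∀ i, IsFiniteKernel (b i)] {l : ℝ} (hl : 0 < l) {C : ℝ≥0∞}
    (hab : ∀ i z (h : Z i → ℝ≥0∞), Measurable h → ∫⁻ y, h y ∂(a' i z) ≤
      C * (∫⁻ y, h y ^ ((l + 1) / l) ∂(b i z)) ^ (l / (l + 1))) (k : ℕ) :
    ∀ h : (∀ j : Fin k, Z j) → ℝ≥0∞, Measurable h → ∫⁻ z, h z ∂(chain a' k) ≤
      C ^ k * (∫⁻ z, h z ^ ((l + 1) / l) ∂(chain b k)) ^ (l / (l + 1)) := by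
  have hl1 : l + 1 ≠ 0 := by positivity
  have hpq : (l + 1) / l * (l / (l + 1)) = 1 := by field_simp
  have hqp : l / (l + 1) * ((l + 1) / l) = 1 := by field_simp
  induction k with
  | zero =>
    intro h hh
    rw [chain, chain, lintegral_dirac' _ hh, lintegral_dirac' _ (hh.pow_const _),
      ← ENNReal.rpow_mul, hpq]
    simp
  | succ k ih =>
    intro h hh
    rw [lintegral_chain_succ a' k hh, lintegral_chain_succ b k (hh.pow_const _)]
    have m1 := measurable_lintegral_append (b k) (hh.pow_const ((l + 1) / l))
    refine (lintegral_mono fun z => hab k z _ (hh.comp (measurable_append_right z))).trans ?_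
    simp only [Function.comp_apply]
    rw [lintegral_const_mul _ (m1.pow_const _), pow_succ', mul_assoc]
    refine mul_le_mul_right ((ih _ (m1.pow_const _)).trans (le_of_eq ?_)) _
    -- The conjugate exponents cancel: the inner integral, raised to `l / (l + 1)` by the last step,
    -- is raised back to the power one by the bound for the prefix.
    simp only [← ENNReal.rpow_mul, hqp, ENNReal.rpow_one]

/-- Hybrid argument: the prefix is truncated before the last step is, so the bad sets are measured
under the chain `a'`, the one controlled by the moment bound. -/
theorem lintegral_chain_le_add_loss {a a' : ∀ i : ℕ, Kernel (∀ j : Fin i, Z j) (Z i)}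
    [∀ i, IsMarkovKernel (a i)] [∀ i, IsFiniteKernel (a' i)] (hle : ∀ i z, a' i z ≤ a i z)
    {G : ∀ i : ℕ, Set (∀ j : Fin i, Z j)} (hG : ∀ i, MeasurableSet (G i)) {d : ℝ≥0∞}
    (hd : ∀ i, ∀ z ∈ G i, ∀ h : Z i → ℝ≥0∞, Measurable h → (∀ y, h y ≤ 1) →
      ∫⁻ y, h y ∂(a i z) ≤ ∫⁻ y, h y ∂(a' i z) + d) (k : ℕ) :
    ∀ h : (∀ j : Fin k, Z j) → ℝ≥0∞, Measurable h → (∀ z, h z ≤ 1) →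
      ∫⁻ z, h z ∂(chain a k) ≤ ∫⁻ z, h z ∂(chain a' k) +
        ∑ i ∈ Finset.range k, (d + chain a' i (G i)ᶜ) := by
  classical
  induction k with
  | zero => intro h hh _; simp [chain]
  | succ k ih =>
    intro h hh h1
    have hm := measurable_lintegral_append (a k) hh
    have hm' := measurable_lintegral_append (a' k) hh
    have hle1 : ∀ z, ∫⁻ y, h (append k (z, y)) ∂(a k z) ≤ 1 := fun z =>
      (lintegral_mono fun y => h1 _).trans (by simp)
    rw [lintegral_chain_succ a k hh, lintegral_chain_succ a' k hh, Finset.sum_range_succ]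
    refine (ih _ hm hle1).trans ?_
    have hpt : ∀ z, ∫⁻ y, h (append k (z, y)) ∂(a k z) ≤
        ∫⁻ y, h (append k (z, y)) ∂(a' k z) + (d + (G k)ᶜ.indicator 1 z) := by
      intro z
      by_cases hz : z ∈ G k
      · refine (hd k z hz _ (hh.comp (measurable_append_right z)) fun y => h1 _).trans ?_
        simp [hz]
      · refine (hle1 z).trans ?_
        rw [Set.indicator_of_mem (by exact hz), ← add_assoc]
        exact le_add_self
    have hmass : chain a' k Set.univ ≤ 1 := (chain_mono hle k _).trans prob_le_one
    have hint : ∫⁻ z, ∫⁻ y, h (append k (z, y)) ∂(a k z) ∂(chain a' k) ≤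
        ∫⁻ z, ∫⁻ y, h (append k (z, y)) ∂(a' k z) ∂(chain a' k) + (d + chain a' k (G k)ᶜ) := by
      refine (lintegral_mono hpt).trans ?_
      rw [lintegral_add_left hm', lintegral_add_left measurable_const, lintegral_const,
        lintegral_indicator_one (hG k).compl]
      gcongr
      exact mul_le_of_le_one_right' hmass
    refine (add_le_add_left hint _).trans (le_of_eq ?_)
    ring

/-- The privacy parameter of `k`-fold advanced composition of `(ε, d)`-indistinguishable steps. -/
noncomputable def advEps (ε d τ' : ℝ) (k : ℕ) : ℝ :=
  ε * Real.sqrt (2 * k * Real.log (1 / τ')) + k * (ε ^ 2 / 2 + d)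

/-- Weighted AM-GM turns a multiplicative moment bound into a factor `exp E` plus an additive error.
-/
theorem exp_mul_rpow_le {w X E l : ℝ} (hw : 0 ≤ w) (hl : 0 < l) :
    Real.exp (X / (l + 1)) * w ^ (l / (l + 1)) ≤ Real.exp E * w + Real.exp (X - l * E) := by
  have hl1 : 0 < l + 1 := by linarith
  have h := Real.geom_mean_le_arith_mean2_weighted (w₁ := l / (l + 1)) (w₂ := 1 / (l + 1))
    (p₁ := Real.exp E * w) (p₂ := Real.exp (X - l * E)) (by positivity) (by positivity)
    (by positivity) (by positivity) (by field_simp)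
  have e : (Real.exp E * w) ^ (l / (l + 1)) * Real.exp (X - l * E) ^ (1 / (l + 1)) =
      Real.exp (X / (l + 1)) * w ^ (l / (l + 1)) := by
    rw [Real.mul_rpow (Real.exp_pos _).le hw, ← Real.exp_mul, ← Real.exp_mul, mul_right_comm,
      ← Real.exp_add]
    congr 2
    field_simp
    ring
  rw [e] at h
  refine h.trans (add_le_add ?_ ?_)
  · exact mul_le_of_le_one_left (by positivity) ((div_le_one hl1).2 (by linarith))
  · exact mul_le_of_le_one_left (by positivity) ((div_le_one hl1).2 (by linarith))

theorem chain_apply_le_advEps {a' b : ∀ i : ℕ, Kernel (∀ j : Fin i, Z j) (Z i)}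
    [∀ i, IsFiniteKernel (a' i)] [∀ i, IsMarkovKernel (b i)] {ε d τ' : ℝ} (hε : 0 < ε)
    (hτ' : τ' ∈ Set.Ioo (0 : ℝ) 1)
    (hab : ∀ i z, ∀ l : ℝ, 0 < l → ∀ h : Z i → ℝ≥0∞, Measurable h → ∫⁻ y, h y ∂(a' i z) ≤
        ENNReal.ofReal (Real.exp (l * ((l + 1) * ε ^ 2 / 2 + d) / (l + 1))) *
          (∫⁻ y, h y ^ ((l + 1) / l) ∂(b i z)) ^ (l / (l + 1))) (k : ℕ)
    {O : Set (∀ j : Fin k, Z j)} (hO : MeasurableSet O) :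
    chain a' k O ≤ ENNReal.ofReal (Real.exp (advEps ε d τ' k)) * chain b k O +
      ENNReal.ofReal τ' := by
  rcases Nat.eq_zero_or_pos k with rfl | hk
  · simp [chain, advEps]
  have hkR : (0 : ℝ) < k := Nat.cast_pos.2 hk
  set L := Real.log (1 / τ') with hL
  have hLpos : 0 < L := Real.log_pos (by rw [lt_div_iff₀ hτ'.1]; linarith [hτ'.2])
  have hexpL : Real.exp (-L) = τ' := by
    rw [hL, ← Real.log_inv, one_div, inv_inv, Real.exp_log hτ'.1]
  set s := Real.sqrt (2 * k * L) with hs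
  have hspos : 0 < s := Real.sqrt_pos.2 (by positivity)
  have hs2 : s ^ 2 = 2 * k * L := Real.sq_sqrt (by positivity)
  -- This order minimises the additive error `exp (k l ((l + 1) ε² / 2 + d) - l E)` for `E = advEps
  -- ε d τ' k`; the minimum is exactly `τ'`.
  set l := s / (k * ε) with hl
  have hlpos : 0 < l := by positivity
  have hpq : (0 : ℝ) < (l + 1) / l := by positivity
  have h := lintegral_chain_le_rpow hlpos (fun i z h hh => hab i z l hlpos h hh) k
    (O.indicator 1) (measurable_one.indicator hO)
  have hind : ∀ z, O.indicator (1 : (∀ j : Fin k, Z j) → ℝ≥0∞) z ^ ((l + 1) / l) = O.indicator 1 z := by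
    intro z
    by_cases hz : z ∈ O <;> simp [hz, hpq]
  simp_rw [hind] at h
  rw [lintegral_indicator_one hO, lintegral_indicator_one hO,
    ← ENNReal.ofReal_pow (Real.exp_pos _).le, ← ofReal_measureReal (μ := chain b k),
    ENNReal.ofReal_rpow_of_nonneg measureReal_nonneg (by positivity),
    ← ENNReal.ofReal_mul (by positivity), ← Real.exp_nat_mul] at h
  refine h.trans ?_
  rw [← ofReal_measureReal (μ := chain b k), ← ENNReal.ofReal_mul (by positivity),
    ← ENNReal.ofReal_add (by positivity) hτ'.1.le]
  refine ENNReal.ofReal_le_ofReal ?_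
  have h2 := exp_mul_rpow_le (w := (chain b k).real O) (l := l) (E := advEps ε d τ' k)
    (X := k * (l * ((l + 1) * ε ^ 2 / 2 + d))) measureReal_nonneg hlpos
  have hX : k * (l * ((l + 1) * ε ^ 2 / 2 + d)) - l * advEps ε d τ' k = -L := by
    have e1 : k * l * ε = s := by rw [hl]; field_simp
    have e2 : l * s * ε = 2 * L := by
      rw [hl]; field_simp; linarith
    have e3 : k * l ^ 2 * ε ^ 2 = 2 * L := by
      calc k * l ^ 2 * ε ^ 2 = l * (k * l * ε) * ε := by ring
        _ = _ := by rw [e1, e2]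
    rw [advEps, ← hL, ← hs]
    linear_combination e3 / 2 - e2
  rw [hX, hexpL] at h2
  rw [← mul_div_assoc]
  exact h2

/-- The directions differ. When `a` is truncated, bad sets must be carried from `a'` to `b`, paying
an exponential factor and `τ'` each time; when `b` is truncated, `b' ≤ b` suffices. -/
theorem chain_apply_le [∀ i, MeasurableSpace.CountablyGenerated (Z i)]
    (a b : ∀ i : ℕ, Kernel (∀ j : Fin i, Z j) (Z i)) [∀ i, IsMarkovKernel (a i)]
    [∀ i, IsMarkovKernel (b i)] {ε d τ' : ℝ} (hε : 0 < ε) (hd : 0 ≤ d)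
    (hτ' : τ' ∈ Set.Ioo (0 : ℝ) 1) {G : ∀ i : ℕ, Set (∀ j : Fin i, Z j)}
    (hG : ∀ i, MeasurableSet (G i)) (hab : ∀ i, ∀ z ∈ G i, Indist ε d (a i z) (b i z)) (k : ℕ)
    {O : Set (∀ j : Fin k, Z j)} (hO : MeasurableSet O) :
    chain a k O ≤ ENNReal.ofReal (Real.exp (advEps ε d τ' k)) * chain b k O +
      ENNReal.ofReal τ' + ∑ i ∈ Finset.range k, (ENNReal.ofReal d + ENNReal.ofReal τ' +
        ENNReal.ofReal (Real.exp (advEps ε d τ' i)) * chain b i (G i)ᶜ) ∧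
    chain b k O ≤ ENNReal.ofReal (Real.exp (advEps ε d τ' k)) * chain a k O +
      ENNReal.ofReal τ' + ∑ i ∈ Finset.range k, (ENNReal.ofReal d + chain b i (G i)ᶜ) := by
  constructor
  · choose a' hfin hle hren hloss using fun i => exists_truncation (a i) (b i) hε hd (hG i) (hab i)
    have h1 := lintegral_chain_le_add_loss hle hG hloss k (O.indicator 1)
      (measurable_one.indicator hO) fun z => Set.indicator_le_self' (fun _ _ => zero_le) z
    rw [lintegral_indicator_one hO, lintegral_indicator_one hO] at h1
    refine h1.trans (add_le_add (chain_apply_le_advEps hε hτ' hren k hO) ?_)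
    refine Finset.sum_le_sum fun i _ => ?_
    rw [add_assoc]
    refine add_le_add_right ?_ _
    rw [add_comm]
    exact chain_apply_le_advEps hε hτ' hren i (hG i).compl
  · choose b' hfin hle hren hloss using fun i =>
      exists_truncation (b i) (a i) hε hd (hG i) fun z hz => (hab i z hz).symm
    have h1 := lintegral_chain_le_add_loss hle hG hloss k (O.indicator 1)
      (measurable_one.indicator hO) fun z => Set.indicator_le_self' (fun _ _ => zero_le) z
    rw [lintegral_indicator_one hO, lintegral_indicator_one hO] at h1
    refine h1.trans (add_le_add (chain_apply_le_advEps hε hτ' hren k hO) ?_)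
    exact Finset.sum_le_sum fun i _ => add_le_add_right (chain_mono hle i _) _

end chain

/-! ### Averaging a kernel over the dataset -/

/-- The output distribution of `A (·, y)` on a dataset drawn from `P`. -/
noncomputable def meanKernel {D Y Z : Type*} [MeasurableSpace D] [MeasurableSpace Y]
    [MeasurableSpace Z] (P : Measure D) (A : Kernel (D × Y) Z) : Kernel Y Z :=
  A ∘ₖ (Kernel.const Y P ×ₖ Kernel.id)

section mean

variable {D Y Z : Type*} [MeasurableSpace D] [MeasurableSpace Y] [MeasurableSpace Z]
  (P : Measure D) [IsProbabilityMeasure P] (A : Kernel (D × Y) Z) [IsMarkovKernel A]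

instance : IsMarkovKernel (meanKernel P A) := by
  unfold meanKernel; infer_instance

theorem meanKernel_real_apply (y : Y) {O : Set Z} (hO : MeasurableSet O) :
    (meanKernel P A y).real O = ∫ x, (A (x, y)).real O ∂P := by
  have h : meanKernel P A y O = ∫⁻ x, A (x, y) O ∂P := by
    rw [meanKernel, Kernel.comp_apply' _ _ _ hO, Kernel.prod_apply, Kernel.const_apply,
      Kernel.id_apply, Measure.prod_dirac,
      lintegral_map (A.measurable_coe hO) measurable_prodMk_right]
  rw [Measure.real, h, ← integral_toReal]
  · rfl
  · exact ((A.measurable_coe hO).comp measurable_prodMk_right).aemeasurable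
  · exact Filter.Eventually.of_forall fun x => measure_lt_top _ _

theorem integral_indicator_compl_le {ν : ℝ} {S : Set D} (hS : MeasurableSet S)
    (hPS : 1 - ν ≤ P.real S) : ∫ x, Sᶜ.indicator (1 : D → ℝ) x ∂P ≤ ν := by
  rw [integral_indicator_one hS.compl, probReal_compl_eq_one_sub hS]
  linarith

/-- The unknown `W` serves only as an intermediate point: averaging over `P` keeps the mean close to
`W` up to an extra `ν`, and the triangle inequality doubles `η`. -/
theorem indist_meanKernel {η τ ν : ℝ} (hτ : 0 ≤ τ) (hν : 0 ≤ ν) (hη : 0 ≤ η) (y : Y)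
    {W : Measure Z} [IsProbabilityMeasure W] {S : Set D} (hS : MeasurableSet S)
    (hPS : 1 - ν ≤ P.real S) (hI : ∀ x ∈ S, Indist η τ (A (x, y)) W) {x : D} (hx : x ∈ S) :
    Indist (2 * η) (τ * (1 + Real.exp η) + Real.exp η * ν) (A (x, y)) (meanKernel P A y) := by
  intro O hO
  have hE : 1 ≤ Real.exp η := Real.one_le_exp hη
  have hE2 : Real.exp (2 * η) = Real.exp η * Real.exp η := by rw [← Real.exp_add]; ring_nf
  have hmeas : Measurable fun x => (A (x, y)).real O :=
    ((A.measurable_coe hO).comp measurable_prodMk_right).ennreal_toReal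
  have hint : Integrable (fun x => (A (x, y)).real O) P :=
    Integrable.of_bound hmeas.aestronglyMeasurable 1 (Filter.Eventually.of_forall fun x => by
      rw [Real.norm_of_nonneg measureReal_nonneg]; exact measureReal_le_one)
  have hind : Integrable (fun x => Sᶜ.indicator (1 : D → ℝ) x) P :=
    (integrable_indicator_iff hS.compl).2 (integrable_const 1).integrableOn
  have hi := integral_indicator_compl_le P hS hPS
  have hw1 : W.real O ≤ 1 := measureReal_le_one
  have hw0 : 0 ≤ W.real O := measureReal_nonneg
  have up : (meanKernel P A y).real O ≤ Real.exp η * W.real O + τ + ν := by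
    rw [meanKernel_real_apply P A y hO]
    have : ∀ x, (A (x, y)).real O ≤ (Real.exp η * W.real O + τ) + Sᶜ.indicator (1 : D → ℝ) x := by
      intro x
      have h1 : (A (x, y)).real O ≤ 1 := measureReal_le_one
      by_cases hx : x ∈ S
      · simpa [hx] using (hI x hx O hO).1
      · simp only [Set.mem_compl_iff, hx, not_false_eq_true, Set.indicator_of_mem, Pi.one_apply]
        nlinarith [mul_nonneg (Real.exp_pos η).le hw0]
    refine (integral_mono hint ((integrable_const _).add hind) this).trans ?_
    rw [integral_add' (integrable_const _) hind]
    simp only [integral_const, probReal_univ, smul_eq_mul, one_mul]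
    linarith
  have lo : W.real O ≤ Real.exp η * (meanKernel P A y).real O + τ + ν := by
    rw [meanKernel_real_apply P A y hO]
    have : ∀ x, W.real O ≤ (Real.exp η * (A (x, y)).real O + τ) + Sᶜ.indicator (1 : D → ℝ) x := by
      intro x
      have h1 : 0 ≤ (A (x, y)).real O := measureReal_nonneg
      by_cases hx : x ∈ S
      · simpa [hx] using (hI x hx O hO).2
      · simp only [Set.mem_compl_iff, hx, not_false_eq_true, Set.indicator_of_mem, Pi.one_apply]
        nlinarith [mul_nonneg (Real.exp_pos η).le h1]
    have h2 := integral_mono (integrable_const (μ := P) (W.real O))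
      (((hint.const_mul (Real.exp η)).add (integrable_const τ)).add hind) this
    rw [integral_add' ((hint.const_mul (Real.exp η)).add (integrable_const τ)) hind,
      integral_add' (hint.const_mul (Real.exp η)) (integrable_const τ), integral_const_mul] at h2
    simp only [integral_const, probReal_univ, smul_eq_mul, one_mul] at h2
    linarith
  obtain ⟨h1, h2⟩ := hI x hx O hO
  rw [hE2]
  constructor
  · nlinarith [mul_le_mul_of_nonneg_left lo (Real.exp_pos η).le]
  · nlinarith [mul_le_mul_of_nonneg_left h2 (Real.exp_pos η).le, mul_le_mul_of_nonneg_right hE hν]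

end mean

/-! ### Composition with explicit error terms -/

theorem advEps_nonneg {ε d τ' : ℝ} (hε : 0 ≤ ε) (hd : 0 ≤ d) (k : ℕ) : 0 ≤ advEps ε d τ' k := by
  unfold advEps; positivity

theorem lintegral_measure_section_le {D Y : Type*} [MeasurableSpace D] [MeasurableSpace Y]
    (P : Measure D) (W : Measure Y) [IsProbabilityMeasure P] [IsProbabilityMeasure W]
    {N : Set (D × Y)} (hN : MeasurableSet N) {c : ℝ≥0∞}
    (h : ∀ y, P ((fun x => (x, y)) ⁻¹' N) ≤ c) :
    ∫⁻ x, W (Prod.mk x ⁻¹' N) ∂P ≤ c := by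
  rw [← Measure.prod_apply hN, Measure.prod_apply_symm hN]
  exact (lintegral_mono h).trans (by simp)

theorem Indist.of_measure_le {Z : Type*} [MeasurableSpace Z] {η τ : ℝ} {μ ρ : Measure Z}
    [IsFiniteMeasure μ] [IsFiniteMeasure ρ] (hτ : 0 ≤ τ)
    (h : ∀ O, MeasurableSet O → μ O ≤ ENNReal.ofReal (Real.exp η) * ρ O + ENNReal.ofReal τ ∧
      ρ O ≤ ENNReal.ofReal (Real.exp η) * μ O + ENNReal.ofReal τ) : Indist η τ μ ρ := by
  have conv : ∀ {μ ρ : Measure Z} [IsFiniteMeasure μ] [IsFiniteMeasure ρ] {O : Set Z},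
      μ O ≤ ENNReal.ofReal (Real.exp η) * ρ O + ENNReal.ofReal τ →
      μ.real O ≤ Real.exp η * ρ.real O + τ := by
    intro μ ρ _ _ O h
    have h0 : 0 ≤ Real.exp η * ρ.real O := mul_nonneg (Real.exp_pos _).le measureReal_nonneg
    rw [← ofReal_measureReal (μ := μ), ← ofReal_measureReal (μ := ρ),
      ← ENNReal.ofReal_mul (Real.exp_pos _).le, ← ENNReal.ofReal_add h0 hτ] at h
    exact (ENNReal.ofReal_le_ofReal_iff (add_nonneg h0 hτ)).1 h
  exact fun O hO => ⟨conv (h O hO).1, conv (h O hO).2⟩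

/-- Here `s` is the Markov threshold for the weighted bad-prefix probability. The budget `t`
collects `τ'` once for the final event and `k` times for the bad sets, `d` at each step, and `s`. -/
theorem exists_indist_composition {D : Type*} [MeasurableSpace D] (P : Measure D)
    [IsProbabilityMeasure P] {Z : ℕ → Type*} [∀ i, MeasurableSpace (Z i)]
    [∀ i, MeasurableSpace.CountablyGenerated (Z i)]
    (A : ∀ i : ℕ, Kernel (D × (∀ j : Fin i, Z j)) (Z i)) [∀ i, IsMarkovKernel (A i)]
    {η τ ν τ' s t η' : ℝ} (hη : 0 < η) (hτ : 0 ≤ τ) (hν : 0 ≤ ν) (hτ' : τ' ∈ Set.Ioo (0 : ℝ) 1)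
    (hs : 0 < s) {k : ℕ}
    (hA : ∀ i < k, ∀ z : (∀ j : Fin i, Z j), ∃ W : ProbabilityMeasure (Z i), ∃ S : Set D,
      MeasurableSet S ∧ 1 - ν ≤ P.real S ∧ ∀ x ∈ S, Indist η τ (A i (x, z)) (W : Measure (Z i)))
    {d : ℝ} (hd : d = τ * (1 + Real.exp η) + Real.exp η * ν)
    (hη' : advEps (2 * η) d τ' k ≤ η') (ht : (k + 1) * τ' + k * d + s ≤ t) :
    ∃ W : ProbabilityMeasure (∀ j : Fin k, Z j), ∃ S : Set D, MeasurableSet S ∧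
      1 - (ν * ∑ i ∈ Finset.range k, Real.exp (advEps (2 * η) d τ' i)) / s ≤ P.real S ∧
      ∀ x ∈ S, Indist η' t (composition A k x) (W : Measure (∀ j : Fin k, Z j)) := by
  have hd0 : 0 ≤ d := by rw [hd]; positivity
  have ht0 : 0 ≤ t := le_trans (by have := hτ'.1; positivity) ht
  set B : ∀ i : ℕ, Kernel (∀ j : Fin i, Z j) (Z i) := fun i => meanKernel P (A i) with hB
  have hBm : ∀ i, IsMarkovKernel (B i) := fun i => by rw [hB]; infer_instance
  -- Pairs of dataset and prefix at which step `i` is far from its average. Pulling `B i` back to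
  -- the product makes both sides kernels on one space, so this set is measurable.
  set N : ∀ i : ℕ, Set (D × (∀ j : Fin i, Z j)) := fun i =>
    {p | Indist (2 * η) d (A i p) ((B i).comap Prod.snd measurable_snd p)}ᶜ with hNdef
  have hN : ∀ i, MeasurableSet (N i) := fun i => (measurableSet_indist _ _ _ _).compl
  set w : ℕ → ℝ := fun i => Real.exp (advEps (2 * η) d τ' i) with hw
  set ell : D → ℝ≥0∞ := fun x => ∑ i ∈ Finset.range k,
    ENNReal.ofReal (w i) * chain B i (Prod.mk x ⁻¹' N i) with hell
  have mell1 : ∀ i, Measurable fun x => chain B i (Prod.mk x ⁻¹' N i) := fun i =>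
    measurable_measure_prodMk_left (hN i)
  have mell : Measurable ell :=
    Finset.measurable_fun_sum _ fun i _ => (mell1 i).const_mul _
  have hsec : ∀ i < k, ∀ z, P ((fun x => (x, z)) ⁻¹' N i) ≤ ENNReal.ofReal ν := by
    intro i hi z
    obtain ⟨W, S, hS, hPS, hI⟩ := hA i hi z
    have hsub : (fun x => (x, z)) ⁻¹' N i ⊆ Sᶜ := by
      intro x hx hxS
      refine hx ?_
      have := indist_meanKernel P (A i) hτ hν hη.le z hS hPS hI hxS
      rw [← hd] at this
      exact this
    refine (measure_mono hsub).trans ?_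
    rw [← ofReal_measureReal]
    refine ENNReal.ofReal_le_ofReal ?_
    rw [probReal_compl_eq_one_sub hS]
    linarith
  have hmean : ∫⁻ x, ell x ∂P ≤ ENNReal.ofReal (ν * ∑ i ∈ Finset.range k, w i) := by
    rw [hell, lintegral_finsetSum _ fun i _ => (mell1 i).const_mul _, Finset.mul_sum,
      ENNReal.ofReal_sum_of_nonneg fun i _ => mul_nonneg hν (Real.exp_pos _).le]
    refine Finset.sum_le_sum fun i hi => ?_
    rw [lintegral_const_mul _ (mell1 i), mul_comm, ENNReal.ofReal_mul hν]
    exact mul_le_mul_left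
      (lintegral_measure_section_le P _ (hN i) (hsec i (Finset.mem_range.1 hi))) _
  refine ⟨⟨chain B k, inferInstance⟩, {x | ell x < ENNReal.ofReal s},
    measurableSet_lt mell measurable_const, ?_, ?_⟩
  · have hcompl : {x | ell x < ENNReal.ofReal s} = {x | ENNReal.ofReal s ≤ ell x}ᶜ := by
      ext x; simp
    rw [hcompl, probReal_compl_eq_one_sub (measurableSet_le measurable_const mell)]
    have hM := meas_ge_le_lintegral_div (μ := P) mell.aemeasurable
      (by simpa using hs : ENNReal.ofReal s ≠ 0) ENNReal.ofReal_ne_top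
    have hM2 := hM.trans (ENNReal.div_le_div_right hmean _)
    rw [← ENNReal.ofReal_div_of_pos hs, ← ofReal_measureReal,
      ENNReal.ofReal_le_ofReal_iff
        (div_nonneg (mul_nonneg hν (Finset.sum_nonneg fun i _ => (Real.exp_pos _).le)) hs.le)] at hM2
    linarith
  · intro x hx
    rw [composition_apply]
    change Indist η' t _ (chain B k)
    refine Indist.of_measure_le ht0 fun O hO => ?_
    have hx' : ell x ≤ ENNReal.ofReal s := le_of_lt hx
    obtain ⟨h1, h2⟩ := chain_apply_le (fun i => (A i).sectR x) B (ε := 2 * η) (d := d) (τ' := τ')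
      (by positivity) hd0 hτ' (G := fun i => (Prod.mk x ⁻¹' N i)ᶜ)
      (fun i => (measurable_prodMk_left (hN i)).compl)
      (fun i z hz => by
        have : (x, z) ∉ N i := hz
        rw [hNdef, Set.notMem_compl_iff] at this
        exact this) k hO
    simp only [compl_compl] at h1 h2
    have hexp : ENNReal.ofReal (Real.exp (advEps (2 * η) d τ' k)) ≤ ENNReal.ofReal (Real.exp η') :=
      ENNReal.ofReal_le_ofReal (Real.exp_le_exp.2 hη')
    have hτ0 := hτ'.1.le
    have hfin : ENNReal.ofReal τ' + (∑ i ∈ Finset.range k, (ENNReal.ofReal d + ENNReal.ofReal τ') +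
        ell x) ≤ ENNReal.ofReal t := by
      refine le_trans (add_le_add_right (add_le_add_right hx' _) _) ?_
      rw [Finset.sum_const, Finset.card_range, ← ENNReal.ofReal_add hd0 hτ0,
        ← ENNReal.ofReal_nsmul, ← ENNReal.ofReal_add (by positivity) hs.le,
        ← ENNReal.ofReal_add hτ0 (by positivity)]
      refine ENNReal.ofReal_le_ofReal (le_trans (le_of_eq ?_) ht)
      rw [nsmul_eq_mul]; ring
    constructor
    · refine h1.trans ?_
      rw [add_assoc]
      refine add_le_add (mul_le_mul_left hexp _) (le_trans (le_of_eq ?_) hfin)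
      rw [hell, Finset.sum_add_distrib]
    · refine h2.trans ?_
      rw [add_assoc]
      refine add_le_add (mul_le_mul_left hexp _) (le_trans ?_ hfin)
      rw [hell, ← Finset.sum_add_distrib]
      refine add_le_add_right (Finset.sum_le_sum fun i _ => add_le_add le_self_add ?_) _
      refine le_mul_of_one_le_left' ?_
      rw [← ENNReal.ofReal_one]
      exact ENNReal.ofReal_le_ofReal (Real.one_le_exp (advEps_nonneg (by positivity) hd0 i))

/-! ### Estimates on the parameters -/

theorem exp_le_of_le_three_halves {η : ℝ} (h : η ≤ 3 / 2) : Real.exp η ≤ 9 / 2 := by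
  have h1 : Real.exp (3 / 2) ≤ 9 / 2 := by
    have h2 : Real.exp (3 / 2) ^ 2 = Real.exp 1 ^ 3 := by
      rw [← Real.exp_nat_mul, ← Real.exp_nat_mul]; norm_num
    have h3 : Real.exp 1 ^ 3 ≤ 2.7182818286 ^ 3 :=
      pow_le_pow_left₀ (Real.exp_pos _).le Real.exp_one_lt_d9.le 3
    refine le_of_sq_le_sq ?_ (by norm_num)
    rw [h2]
    refine h3.trans (by norm_num)
  exact (Real.exp_le_exp.2 h).trans h1

theorem exp_two_mul_le {η : ℝ} (h : η ≤ 3 / 2) : Real.exp (2 * η) ≤ 81 / 4 := by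
  have h1 := exp_le_of_le_three_halves h
  have h2 : Real.exp (2 * η) = Real.exp η * Real.exp η := by rw [← Real.exp_add]; ring_nf
  rw [h2]
  nlinarith [Real.exp_pos η]

theorem one_sub_exp_neg_ge {η : ℝ} (hη : η ∈ Set.Ioc (0 : ℝ) (3 / 2)) :
    2 / 5 * η ≤ 1 - Real.exp (-η) := by
  have h1 : 1 + η ≤ Real.exp η := by linarith [Real.add_one_le_exp η]
  have h0 := hη.1
  have h2 : Real.exp (-η) ≤ 1 / (1 + η) := by
    rw [Real.exp_neg, ← one_div]
    exact one_div_le_one_div_of_le (by linarith) h1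
  have h3 : 1 / (1 + η) ≤ 1 - 2 / 5 * η := by
    rw [div_le_iff₀ (by linarith)]
    nlinarith [hη.2]
  linarith

theorem tauHat_le {η τ : ℝ} (hη : η ∈ Set.Ioc (0 : ℝ) (3 / 2)) (hτ : 0 ≤ τ) :
    tauHat η τ ≤ 5 * (τ / η) := by
  have h := one_sub_exp_neg_ge hη
  have h0 := hη.1
  rw [tauHat, div_le_iff₀ (by linarith)]
  calc 2 * τ = 5 * (τ / η) * (2 / 5 * η) := by field_simp
    _ ≤ _ := mul_le_mul_of_nonneg_left h (by positivity)

theorem two_mul_le_tauHat {η τ : ℝ} (hη : 0 < η) (hτ : 0 ≤ τ) : 2 * τ ≤ tauHat η τ := by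
  have h1 : 0 < 1 - Real.exp (-η) := by
    have : Real.exp (-η) < 1 := by
      rw [← Real.exp_zero]; exact Real.exp_lt_exp.2 (by linarith)
    linarith
  rw [tauHat, le_div_iff₀ h1]
  nlinarith [Real.exp_pos (-η)]

theorem tauHat_le_tenth {η τ : ℝ} (hη : η ∈ Set.Ioc (0 : ℝ) (3 / 2))
    (hτ : τ ∈ Set.Ioc 0 (η / 50)) : tauHat η τ ≤ 1 / 10 := by
  have h := tauHat_le hη hτ.1.le
  have h2 : τ / η ≤ 1 / 50 := by
    rw [div_le_iff₀ hη.1]; linarith [hτ.2]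
  linarith

theorem psi_bracket_bounds {η : ℝ} (hη : η ∈ Set.Ioc (0 : ℝ) (3 / 2)) :
    0 ≤ 4 * Real.exp (2 * η) + 4 * Real.exp η - 3 - 2 * Real.exp (-η) + Real.exp (-2 * η) ∧
    4 * Real.exp (2 * η) + 4 * Real.exp η - 3 - 2 * Real.exp (-η) + Real.exp (-2 * η) ≤ 100 := by
  have h0 := hη.1
  have h1 : 1 ≤ Real.exp (2 * η) := Real.one_le_exp (by linarith)
  have h2 : 1 ≤ Real.exp η := Real.one_le_exp (by linarith)
  have h3 : Real.exp (-η) ≤ 1 := Real.exp_le_one_iff.2 (by linarith)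
  have h4 : Real.exp (-2 * η) ≤ 1 := Real.exp_le_one_iff.2 (by linarith)
  have h5 := exp_le_of_le_three_halves hη.2
  have h6 := exp_two_mul_le hη.2
  have h7 := Real.exp_pos (-η)
  have h8 := Real.exp_pos (-2 * η)
  constructor <;> linarith

theorem le_psi {η τ : ℝ} (hη : η ∈ Set.Ioc (0 : ℝ) (3 / 2)) :
    τ * (2 * Real.exp η + 1) ≤ psi η τ := by
  have h := (psi_bracket_bounds hη).1
  rw [psi]
  refine le_add_of_nonneg_right (mul_nonneg (sq_nonneg _) (add_nonneg zero_le_one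
    (mul_nonneg (div_nonneg ?_ (sq_nonneg _)) h)))
  positivity

theorem psi_le {η τ : ℝ} (hη : η ∈ Set.Ioc (0 : ℝ) (3 / 2)) (hτ : 0 ≤ τ) :
    psi η τ ≤ 5000 * (τ + τ ^ 2 / η ^ 2) := by
  obtain ⟨h1, h2⟩ := psi_bracket_bounds hη
  have h0 := hη.1
  have h5 := exp_le_of_le_three_halves hη.2
  have h6 := exp_two_mul_le hη.2
  rw [psi]
  set Q := 4 * Real.exp (2 * η) + 4 * Real.exp η - 3 - 2 * Real.exp (-η) + Real.exp (-2 * η)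
  have h7 : η ≤ Real.exp η - 1 := by linarith [Real.add_one_le_exp η]
  have h8 : 2 * Real.exp (2 * η) / (Real.exp η - 1) ^ 2 ≤ (81 / 2) / η ^ 2 :=
    div_le_div₀ (by norm_num) (by linarith) (by positivity) (pow_le_pow_left₀ h0.le h7 2)
  have h9 : 2 * Real.exp (2 * η) / (Real.exp η - 1) ^ 2 * Q ≤ (81 / 2) / η ^ 2 * 100 :=
    mul_le_mul h8 h2 h1 (by positivity)
  have h10 : (1 : ℝ) ≤ (9 / 4) / η ^ 2 := by
    rw [le_div_iff₀ (by positivity)]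
    nlinarith [hη.2]
  have h11 : τ * (2 * Real.exp η + 1) ≤ 10 * τ := by nlinarith
  have h12 : τ ^ 2 * (1 + 2 * Real.exp (2 * η) / (Real.exp η - 1) ^ 2 * Q) ≤
      τ ^ 2 * (5000 / η ^ 2) := by
    refine mul_le_mul_of_nonneg_left ?_ (sq_nonneg _)
    calc _ ≤ (9 / 4) / η ^ 2 + (81 / 2) / η ^ 2 * 100 := add_le_add h10 h9
      _ = (9 / 4 + 81 / 2 * 100) / η ^ 2 := by ring
      _ ≤ _ := div_le_div_of_nonneg_right (by norm_num) (by positivity)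
  have h13 : τ ^ 2 * (5000 / η ^ 2) = 5000 * (τ ^ 2 / η ^ 2) := by ring
  linarith

theorem abs_tauHat_le_and_abs_psi_le {η τ : ℝ} (hη : η ∈ Set.Ioc (0 : ℝ) (3 / 2)) (hτ : 0 ≤ τ) :
    |tauHat η τ| ≤ 5000 * (τ / η) ∧ |psi η τ| ≤ 5000 * (τ + τ ^ 2 / η ^ 2) := by
  have h0 := hη.1
  constructor
  · rw [abs_of_nonneg (by linarith [two_mul_le_tauHat h0 hτ])]
    have := tauHat_le hη hτ
    have : 0 ≤ τ / η := by positivity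
    linarith
  · rw [abs_of_nonneg ((mul_nonneg hτ (by positivity)).trans (le_psi hη))]
    exact psi_le hη hτ

/-- Shows that the drift in `etaStep` dominates the per-step drift of `advEps` at `2η`, apart from
the part of `d` containing `ν`. -/
theorem le_drift {η τ : ℝ} (hη : η ∈ Set.Ioc (0 : ℝ) (3 / 2)) (hτ : τ ∈ Set.Ioc 0 (η / 50)) :
    (2 * η) ^ 2 / 2 + τ * (1 + Real.exp η) ≤
      2 * η * (Real.exp (2 * η) / (1 - tauHat η τ) - 1) + psi η τ := by
  have h0 := hη.1
  have h1 := tauHat_le_tenth hη hτ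
  have h2 := two_mul_le_tauHat h0 hτ.1.le
  have h3 : 1 + 2 * η ≤ Real.exp (2 * η) := by linarith [Real.add_one_le_exp (2 * η)]
  have h4 : Real.exp (2 * η) ≤ Real.exp (2 * η) / (1 - tauHat η τ) :=
    le_div_self (Real.exp_pos _).le (by linarith) (by linarith [hτ.1])
  have h5 : 2 * η * (2 * η) ≤ 2 * η * (Real.exp (2 * η) / (1 - tauHat η τ) - 1) :=
    mul_le_mul_of_nonneg_left (by linarith) (by linarith)
  have h6 := le_psi (τ := τ) hη
  have h7 : τ * (1 + Real.exp η) ≤ τ * (2 * Real.exp η + 1) :=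
    mul_le_mul_of_nonneg_left (by linarith [Real.exp_pos η]) hτ.1.le
  nlinarith

theorem drift_nonneg {η τ : ℝ} (hη : η ∈ Set.Ioc (0 : ℝ) (3 / 2)) (hτ : τ ∈ Set.Ioc 0 (η / 50)) :
    0 ≤ 2 * η * (Real.exp (2 * η) / (1 - tauHat η τ) - 1) + psi η τ := by
  refine le_trans ?_ (le_drift hη hτ)
  have := hτ.1
  positivity

theorem drift_le {η τ C₁ : ℝ} (hη : η ∈ Set.Ioc (0 : ℝ) (3 / 2)) (hτ : τ ∈ Set.Ioc 0 (η / 50))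
    (hC : 0 < C₁) (hτC : τ ≤ C₁ * η ^ 2) :
    2 * η * (Real.exp (2 * η) / (1 - tauHat η τ) - 1) + psi η τ ≤
      (90 + 12 * C₁ + 5000 * (C₁ + C₁ ^ 2)) * η ^ 2 := by
  have h0 := hη.1
  have hτ0 := hτ.1
  have h1 := tauHat_le_tenth hη hτ
  have h2 := two_mul_le_tauHat h0 hτ0.le
  have h3 : tauHat η τ ≤ 5 * (C₁ * η) := by
    refine (tauHat_le hη hτ0.le).trans (mul_le_mul_of_nonneg_left ?_ (by norm_num))
    rw [div_le_iff₀ h0]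
    linarith
  have h4 : Real.exp (2 * η) - 1 ≤ 81 / 2 * η := by
    have e1 : 1 - 2 * η ≤ Real.exp (-(2 * η)) := by linarith [Real.add_one_le_exp (-(2 * η))]
    have e2 := mul_le_mul_of_nonneg_left e1 (Real.exp_pos (2 * η)).le
    rw [← Real.exp_add, add_neg_cancel, Real.exp_zero] at e2
    nlinarith [exp_two_mul_le hη.2]
  -- Dividing by `1 - tauHat ≥ 9/10` turns `81/2` into `45` and the `5` of `h3` into less than `6`.
  have h5 : Real.exp (2 * η) / (1 - tauHat η τ) - 1 ≤ (45 + 6 * C₁) * η := by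
    rw [sub_le_iff_le_add, div_le_iff₀ (by linarith)]
    have : 0 ≤ C₁ * η := by positivity
    nlinarith
  have h6 := psi_le hη hτ0.le
  have h7 : τ ^ 2 / η ^ 2 ≤ C₁ ^ 2 * η ^ 2 := by
    rw [div_le_iff₀ (by positivity)]
    calc τ ^ 2 ≤ (C₁ * η ^ 2) ^ 2 := pow_le_pow_left₀ hτ0.le hτC 2
      _ = _ := by ring
  have h8 := mul_le_mul_of_nonneg_left h5 (by linarith : 0 ≤ 2 * η)
  nlinarith

/-! ### The composed parameters and the slack they leave -/

theorem etaStep_nonneg {η τ : ℝ} (τ' : ℝ) (hη : η ∈ Set.Ioc (0 : ℝ) (3 / 2))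
    (hτ : τ ∈ Set.Ioc 0 (η / 50)) (j : ℕ) : 0 ≤ etaStep η τ τ' j := by
  have := drift_nonneg hη hτ
  have := hη.1
  rw [etaStep]
  positivity

theorem etaStep_mono {η τ τ' : ℝ} (hη : η ∈ Set.Ioc (0 : ℝ) (3 / 2))
    (hτ : τ ∈ Set.Ioc 0 (η / 50)) (hτ' : τ' ∈ Set.Ioo (0 : ℝ) 1) :
    Monotone (etaStep η τ τ') := by
  intro i j hij
  have hD := drift_nonneg hη hτ
  have h0 := hη.1
  have hij' : (i : ℝ) ≤ j := Nat.cast_le.2 hij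
  have hL : 0 ≤ Real.log (1 / τ') :=
    Real.log_nonneg (by rw [le_div_iff₀ hτ'.1]; linarith [hτ'.2])
  rw [etaStep, etaStep]
  gcongr

theorem etaStar_eq (k : ℕ) (η τ τ' : ℝ) : etaStar k η τ τ' = 3 * etaStep η τ τ' k := by
  rw [etaStar, etaStep]; ring

theorem sum_range_eq_one_add_sum_Icc {f : ℕ → ℝ} (hf : f 0 = 1) {k : ℕ} (hk : 1 ≤ k) :
    ∑ i ∈ Finset.range k, f i = 1 + ∑ i ∈ Finset.Icc 1 (k - 1), f i := by
  obtain ⟨m, rfl⟩ := Nat.exists_eq_add_of_le' hk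
  rw [Finset.sum_range_succ', hf, add_comm, Finset.range_eq_Ico, Finset.sum_Ico_add',
    Nat.add_sub_cancel]
  rfl

theorem advEps_le_etaStep {η τ : ℝ} (ν τ' : ℝ) (hη : η ∈ Set.Ioc (0 : ℝ) (3 / 2))
    (hτ : τ ∈ Set.Ioc 0 (η / 50)) (i : ℕ) :
    advEps (2 * η) (τ * (1 + Real.exp η) + Real.exp η * ν) τ' i ≤
      etaStep η τ τ' i + i * (Real.exp η * ν) := by
  have h := mul_le_mul_of_nonneg_left (le_drift hη hτ) (Nat.cast_nonneg (α := ℝ) i)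
  rw [advEps, etaStep]
  nlinarith

theorem IsTypicallyStable.mono {X Z : Type*} [MeasurableSpace X] [MeasurableSpace Z] {n : ℕ}
    {Ps : Set (ProbabilityMeasure (Fin n → X))} {η τ ν η' τ' ν' : ℝ} {A : Kernel (Fin n → X) Z}
    (h : IsTypicallyStable Ps η τ ν A) (hη : η ≤ η') (hτ : τ ≤ τ') (hν : ν ≤ ν') :
    IsTypicallyStable Ps η' τ' ν' A := by
  intro P hP
  obtain ⟨W, S, hS, hPS, hI⟩ := h P hP
  refine ⟨W, S, hS, by linarith, fun x hx O hO => ?_⟩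
  have hE := Real.exp_le_exp.2 hη
  obtain ⟨h1, h2⟩ := hI x hx O hO
  exact ⟨h1.trans (add_le_add (mul_le_mul_of_nonneg_right hE measureReal_nonneg) hτ),
    h2.trans (add_le_add (mul_le_mul_of_nonneg_right hE measureReal_nonneg) hτ)⟩

theorem isTypicallyStable_of_one_le {X Z : Type*} [MeasurableSpace X] [MeasurableSpace Z] {n : ℕ}
    (Ps : Set (ProbabilityMeasure (Fin n → X))) {η τ ν : ℝ} (A : Kernel (Fin n → X) Z)
    [IsMarkovKernel A] (hν : 1 ≤ ν) : IsTypicallyStable Ps η τ ν A := by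
  intro P _
  have : Nonempty (Fin n → X) := (P : Measure (Fin n → X)).nonempty_of_neZero
  exact ⟨⟨A (Classical.arbitrary _), inferInstance⟩, ∅, MeasurableSet.empty, by simp [hν],
    fun x hx => hx.elim⟩

theorem tauStar_sq {k : ℕ} {η τ ν τ' : ℝ} (hk : 2 ≤ k) (hη : η ∈ Set.Ioc (0 : ℝ) (3 / 2))
    (hτ : τ ∈ Set.Ioc 0 (η / 50)) (hν : 0 < ν) (hτ' : τ' ∈ Set.Ioo (0 : ℝ) 1) :
    0 < tauStar k η τ ν τ' ∧ 2 * η * tauStar k η τ ν τ' ^ 2 =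
      25 * (k * tauHat η τ + k * τ' + ν * ∑ i ∈ Finset.range k, Real.exp (etaStep η τ τ' i)) := by
  have hη0 := hη.1
  have hτ'0 := hτ'.1
  have hk0 : (0 : ℝ) < k := by exact_mod_cast (by omega : 0 < k)
  have hhat : 0 < tauHat η τ := by linarith [two_mul_le_tauHat hη0 hτ.1.le, hτ.1]
  set T := ∑ i ∈ Finset.range k, Real.exp (etaStep η τ τ' i) with hT
  have hT0 : 0 ≤ T := Finset.sum_nonneg fun i _ => (Real.exp_pos _).le
  have hTIcc : T = 1 + ∑ i ∈ Finset.Icc 1 (k - 1), Real.exp (etaStep η τ τ' i) :=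
    sum_range_eq_one_add_sum_Icc (by simp [etaStep]) (by omega)
  have htB : tauStar k η τ ν τ' =
      5 * Real.sqrt ((k * tauHat η τ + k * τ' + ν * T) / (2 * η)) := by
    rw [tauStar, hTIcc, ← Finset.sum_mul]
    congr 2
    ring
  rw [htB]
  refine ⟨by positivity, ?_⟩
  rw [mul_pow, Real.sq_sqrt (by positivity)]
  field_simp
  norm_num

theorem natCast_le_sum_exp_etaStep {η τ : ℝ} (τ' : ℝ) (hη : η ∈ Set.Ioc (0 : ℝ) (3 / 2))
    (hτ : τ ∈ Set.Ioc 0 (η / 50)) (k : ℕ) :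
    (k : ℝ) ≤ ∑ i ∈ Finset.range k, Real.exp (etaStep η τ τ' i) := by
  have : ∑ i ∈ Finset.range k, (1 : ℝ) ≤ ∑ i ∈ Finset.range k, Real.exp (etaStep η τ τ' i) :=
    Finset.sum_le_sum fun i _ => Real.one_le_exp (etaStep_nonneg τ' hη hτ i)
  simpa using this

/-- Smallness of `k τ'` forces `log (1 / τ') ≥ 1`, hence `etaStep ≥ 4η`. The `ν` term then fits into
the factor `3` between `etaStep` and `etaStar`. -/
theorem advEps_le_etaStar {k : ℕ} {η τ ν τ' : ℝ} (hk : 2 ≤ k) (hη : η ∈ Set.Ioc (0 : ℝ) (3 / 2))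
    (hτ : τ ∈ Set.Ioc 0 (η / 50)) (hν : k * (Real.exp η * ν) ≤ 9 / 25 * η) (hτ'0 : 0 < τ')
    (hkτ' : k * τ' ≤ 2 * η / 25) :
    advEps (2 * η) (τ * (1 + Real.exp η) + Real.exp η * ν) τ' k ≤ etaStar k η τ τ' := by
  have hkR : (2 : ℝ) ≤ k := by exact_mod_cast hk
  have hη0 := hη.1
  have hL : 1 ≤ Real.log (1 / τ') := by
    rw [Real.le_log_iff_exp_le (by positivity), le_div_iff₀ hτ'0]
    have h1 : 2 * τ' ≤ k * τ' := mul_le_mul_of_nonneg_right hkR hτ'0.le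
    have h2 : τ' ≤ 3 / 50 := by linarith [hη.2]
    nlinarith [Real.exp_one_lt_d9]
  have hsqrt : 2 ≤ Real.sqrt (2 * k * Real.log (1 / τ')) := by
    refine Real.le_sqrt_of_sq_le ?_
    nlinarith
  refine (advEps_le_etaStep ν τ' hη hτ k).trans ?_
  rw [etaStar_eq]
  have h2 : 2 * 2 * η ≤ etaStep η τ τ' k := by
    rw [etaStep]
    have h3 := mul_nonneg (Nat.cast_nonneg (α := ℝ) k) (drift_nonneg hη hτ)
    have h4 : 2 * 2 * η ≤ 2 * Real.sqrt (2 * k * Real.log (1 / τ')) * η :=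
      mul_le_mul_of_nonneg_right (by linarith) hη0.le
    linarith
  linarith

/-- The `ν` term adds at most `9/25 * 3/2 = 27/50 < log 2` to each exponent, whence the factor `2`.
-/
theorem sum_exp_advEps_le {k : ℕ} {η τ ν τ' : ℝ} (hη : η ∈ Set.Ioc (0 : ℝ) (3 / 2))
    (hτ : τ ∈ Set.Ioc 0 (η / 50)) (hν0 : 0 ≤ ν) (hν : k * (Real.exp η * ν) ≤ 9 / 25 * η) :
    ∑ i ∈ Finset.range k,
        Real.exp (advEps (2 * η) (τ * (1 + Real.exp η) + Real.exp η * ν) τ' i) ≤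
      2 * ∑ i ∈ Finset.range k, Real.exp (etaStep η τ τ' i) := by
  rw [Finset.mul_sum]
  refine Finset.sum_le_sum fun i hi => ?_
  have hik : (i : ℝ) ≤ k := Nat.cast_le.2 (Finset.mem_range.1 hi).le
  have h1 := advEps_le_etaStep ν τ' hη hτ i
  have h2 : i * (Real.exp η * ν) ≤ k * (Real.exp η * ν) :=
    mul_le_mul_of_nonneg_right hik (by positivity)
  have h3 := Real.log_two_gt_d9
  rw [← Real.exp_log two_pos, ← Real.exp_add, Real.exp_log two_pos]
  exact Real.exp_le_exp.2 (by linarith [hη.2])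

theorem stableUnderComposition_etaStar {X : Type u} [MeasurableSpace X] {n : ℕ}
    (Ps : Set (ProbabilityMeasure (Fin n → X))) {k : ℕ} {η τ ν τ' : ℝ} (hk : 2 ≤ k)
    (hη : η ∈ Set.Ioc (0 : ℝ) (3 / 2)) (hτ : τ ∈ Set.Ioc 0 (η / 50)) (hν : 0 < ν)
    (hτ' : τ' ∈ Set.Ioo (0 : ℝ) 1) :
    StableUnderComposition.{u, v} Ps k η τ ν (etaStar k η τ τ') (tauStar k η τ ν τ')
      (tauStar k η τ ν τ') := by
  intro Z _ _ A _ hA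
  obtain ⟨htpos, ht2⟩ := tauStar_sq hk hη hτ hν hτ'
  have hTk := natCast_le_sum_exp_etaStep τ' hη hτ k
  generalize tauStar k η τ ν τ' = t at htpos ht2 ⊢
  rcases le_or_gt 1 t with h1t | ht1
  · exact isTypicallyStable_of_one_le Ps _ h1t
  have hη0 := hη.1
  have hτ0 := hτ.1
  have hτ'0 := hτ'.1
  have hkR : (1 : ℝ) ≤ k := by exact_mod_cast (by omega : 1 ≤ k)
  have hexp := exp_le_of_le_three_halves hη.2
  have hhat := mul_le_mul_of_nonneg_left (two_mul_le_tauHat hη0 hτ0.le) (by linarith : 0 ≤ (k : ℝ))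
  have hνT := mul_le_mul_of_nonneg_left hTk hν.le
  have hνk : 0 < ν * k := by positivity
  have hkτ : 0 < (k : ℝ) * τ := by positivity
  have hkτ' : τ' ≤ k * τ' := le_mul_of_one_le_left hτ'0.le hkR
  have htt : t ^ 2 ≤ t := by
    rw [sq]; exact mul_le_of_le_one_left htpos.le ht1.le
  have hηt1 : 2 * η * t ^ 2 ≤ 2 * η :=
    mul_le_of_le_one_right (by linarith) (by linarith)
  have hηt : 2 * η * t ^ 2 ≤ 3 * t ^ 2 :=
    mul_le_mul_of_nonneg_right (by linarith [hη.2]) (sq_nonneg t)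
  have hkexp : k * (Real.exp η * ν) ≤ 9 / 2 * (ν * k) := by
    calc k * (Real.exp η * ν) = Real.exp η * (ν * k) := by ring
      _ ≤ _ := mul_le_mul_of_nonneg_right hexp hνk.le
  -- Since `t < 1`, `ht2` with `hνT` gives `ν k ≤ 2η / 25`, and `e^η ≤ 9/2`.
  have hslack : k * (Real.exp η * ν) ≤ 9 / 25 * η := by linarith
  have hstep := advEps_le_etaStar hk hη hτ hslack hτ'0 (by linarith)
  have hsum := mul_le_mul_of_nonneg_left (sum_exp_advEps_le (τ' := τ') hη hτ hν.le hslack) hν.le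
  have hbudget : (k + 1) * τ' + k * (τ * (1 + Real.exp η) + Real.exp η * ν) ≤ 3 / 5 * t := by
    have e1 := mul_le_mul_of_nonneg_left (by linarith : 1 + Real.exp η ≤ 11 / 2) hkτ.le
    linarith
  have hpos : 0 < ∑ i ∈ Finset.range k,
      Real.exp (advEps (2 * η) (τ * (1 + Real.exp η) + Real.exp η * ν) τ' i) :=
    Finset.sum_pos (fun i _ => Real.exp_pos _) (Finset.nonempty_range_iff.2 (by omega))
  have hst : ν * (∑ i ∈ Finset.range k,
      Real.exp (advEps (2 * η) (τ * (1 + Real.exp η) + Real.exp η * ν) τ' i)) / t ≤ 2 / 5 * t := by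
    rw [div_le_iff₀ htpos, mul_assoc, ← sq]
    linarith
  intro P hP
  -- The threshold `s` is the mean bound divided by `t`, so that the failure probability is exactly
  -- `t`; `s` uses `2/5` of the additive budget and the other errors use `3/5`.
  obtain ⟨W, S, hS, hPS, hI⟩ := exists_indist_composition (P : Measure (Fin n → X)) A hη0 hτ0.le
    hν.le hτ' (div_pos (mul_pos hν hpos) htpos) (fun i hi z => hA i hi z P hP) rfl hstep
    (add_le_add hbudget hst)
  refine ⟨W, S, hS, ?_, fun x hx => ?_⟩
  · rwa [div_div_cancel₀ (mul_pos hν hpos).ne'] at hPS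
  · have h5 : 3 / 5 * t + 2 / 5 * t = t := by ring
    rw [← h5]
    exact hI x hx

/-! ### Asymptotic form -/

/-- The drift is of order `k η²`; the assumption on `η` bounds one factor `k η` by `C₂ √(k log
(1/τ'))`, the order of the main term. -/
theorem etaStar_le {k : ℕ} {η τ τ' C₁ C₂ : ℝ} (hk : 2 ≤ k) (hη : η ∈ Set.Ioc (0 : ℝ) (3 / 2))
    (hτ : τ ∈ Set.Ioc 0 (η / 50)) (hC₁ : 0 < C₁)
    (hτC : τ ≤ C₁ * η ^ 2) (hηC : η ≤ C₂ * Real.sqrt (Real.log (1 / τ') / k)) :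
    etaStar k η τ τ' ≤ (12 + 3 * (90 + 12 * C₁ + 5000 * (C₁ + C₁ ^ 2)) * C₂) *
      (Real.sqrt k * η * Real.sqrt (Real.log (1 / τ'))) := by
  have hη0 := hη.1
  have hk0 : (0 : ℝ) < k := by exact_mod_cast (by omega : 0 < k)
  set L := Real.log (1 / τ')
  set K := 90 + 12 * C₁ + 5000 * (C₁ + C₁ ^ 2) with hK
  have hK0 : 0 ≤ K := by positivity
  have hD := drift_le hη hτ hC₁ hτC
  have hsq : Real.sqrt (2 * k * L) ≤ 2 * (Real.sqrt k * Real.sqrt L) := by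
    rw [mul_assoc, Real.sqrt_mul zero_le_two, Real.sqrt_mul hk0.le]
    refine mul_le_mul_of_nonneg_right ?_ (by positivity)
    rw [Real.sqrt_le_left zero_le_two]; norm_num
  have hkη : k * η ≤ C₂ * (Real.sqrt k * Real.sqrt L) := by
    have hss := Real.mul_self_sqrt hk0.le
    calc k * η ≤ k * (C₂ * Real.sqrt (L / k)) := mul_le_mul_of_nonneg_left hηC hk0.le
      _ = C₂ * (Real.sqrt k * Real.sqrt L) := by
        rw [Real.sqrt_div' _ hk0.le]
        nth_rewrite 1 [← hss]
        have : Real.sqrt k ≠ 0 := (Real.sqrt_pos.2 hk0).ne'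
        field_simp
  rw [etaStar]
  calc 6 * Real.sqrt (2 * k * L) * η +
        3 * k * (2 * η * (Real.exp (2 * η) / (1 - tauHat η τ) - 1) + psi η τ)
      ≤ 6 * (2 * (Real.sqrt k * Real.sqrt L)) * η + 3 * k * (K * η ^ 2) := by gcongr
    _ = 12 * (Real.sqrt k * η * Real.sqrt L) + 3 * K * η * (k * η) := by ring
    _ ≤ 12 * (Real.sqrt k * η * Real.sqrt L) +
        3 * K * η * (C₂ * (Real.sqrt k * Real.sqrt L)) := by gcongr
    _ = _ := by ring

theorem tauStar_le {k : ℕ} {η τ ν τ' : ℝ} (hk : 2 ≤ k) (hη : η ∈ Set.Ioc (0 : ℝ) (3 / 2))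
    (hτ : τ ∈ Set.Ioc 0 (η / 50)) (hν : 0 < ν) (hτ' : τ' ∈ Set.Ioo (0 : ℝ) 1) :
    tauStar k η τ ν τ' ≤ 10 * (Real.sqrt (k * (τ / η ^ 2 + τ' / η)) +
      Real.sqrt (k * ν / η) * Real.exp (etaStar k η τ τ')) := by
  have hη0 := hη.1
  have hτ0 := hτ.1
  have hτ'0 := hτ'.1
  have hk0 : (0 : ℝ) < k := by exact_mod_cast (by omega : 0 < k)
  set H := etaStar k η τ τ' with hH
  have hH0 : 0 ≤ H := by
    rw [hH, etaStar_eq]; linarith [etaStep_nonneg τ' hη hτ k]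
  have hsum : 1 + ∑ i ∈ Finset.Icc 1 (k - 1), Real.exp (etaStep η τ τ' i) ≤ k * Real.exp H := by
    rw [← sum_range_eq_one_add_sum_Icc (f := fun i => Real.exp (etaStep η τ τ' i))
      (by simp [etaStep]) (by omega)]
    calc _ ≤ ∑ i ∈ Finset.range k, Real.exp H := by
          refine Finset.sum_le_sum fun i hi => Real.exp_le_exp.2 ?_
          have h1 := etaStep_mono hη hτ hτ' (Finset.mem_range.1 hi).le
          rw [hH, etaStar_eq]
          linarith [etaStep_nonneg τ' hη hτ k]
      _ = _ := by simp
  -- The square root would leave only `e^{H/2}`; weakening to `e^{2H}` first gives the factor `e^H`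
  -- of the claim.
  have hexpH : Real.exp H ≤ Real.exp H ^ 2 := by
    have := Real.one_le_exp hH0
    nlinarith
  have hhat := tauHat_le hη hτ0.le
  have hB : k * ((tauHat η τ + τ') / (2 * η)) + ν / (2 * η) +
      ∑ i ∈ Finset.Icc 1 (k - 1), Real.exp (etaStep η τ τ' i) * (ν / (2 * η)) ≤
      2 ^ 2 * (k * (τ / η ^ 2 + τ' / η)) + k * ν / η * Real.exp H ^ 2 := by
    rw [← Finset.sum_mul]
    have e1 : (tauHat η τ + τ') / (2 * η) ≤ 2 ^ 2 * (τ / η ^ 2 + τ' / η) := by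
      rw [div_le_iff₀ (by positivity)]
      have e : 2 ^ 2 * (τ / η ^ 2 + τ' / η) * (2 * η) = 8 * (τ / η) + 8 * τ' := by
        field_simp
        ring
      rw [e]
      have : 0 ≤ τ / η := by positivity
      linarith
    have e2 := mul_le_mul_of_nonneg_right hsum (by positivity : 0 ≤ ν / (2 * η))
    have e3 : k * Real.exp H * (ν / (2 * η)) ≤ k * ν / η * Real.exp H ^ 2 := by
      have : k * Real.exp H * (ν / (2 * η)) = k * ν / η * (Real.exp H / 2) := by field_simp
      rw [this]
      refine mul_le_mul_of_nonneg_left ?_ (by positivity)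
      linarith [Real.exp_pos H]
    have e4 := mul_le_mul_of_nonneg_left e1 hk0.le
    linarith
  rw [tauStar]
  have h1 := Real.sqrt_le_sqrt hB
  have h2 : Real.sqrt (2 ^ 2 * (k * (τ / η ^ 2 + τ' / η)) + k * ν / η * Real.exp H ^ 2) ≤
      Real.sqrt (2 ^ 2 * (k * (τ / η ^ 2 + τ' / η))) + Real.sqrt (k * ν / η * Real.exp H ^ 2) := by
    refine Real.sqrt_le_iff.2 ⟨by positivity, ?_⟩
    rw [add_sq, Real.sq_sqrt (by positivity), Real.sq_sqrt (by positivity)]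
    exact add_le_add_left (le_add_of_nonneg_right (by positivity)) _
  rw [Real.sqrt_mul (by positivity), Real.sqrt_mul (x := k * ν / η) (by positivity),
    Real.sqrt_sq zero_le_two, Real.sqrt_sq (Real.exp_pos _).le] at h2
  have : 0 ≤ Real.sqrt (k * ν / η) * Real.exp H := by positivity
  linarith

end TypicalStability

theorem mainTheorem2 :
    -- the composition theorem
    (∀ (X : Type u) [MeasurableSpace X] (n : ℕ) (Ps : Set (ProbabilityMeasure (Fin n → X)))
      (k : ℕ) (η τ ν τ' : ℝ), 2 ≤ k → η ∈ Set.Ioc (0 : ℝ) (3 / 2) → τ ∈ Set.Ioc 0 (η / 50) →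
      ν ∈ Set.Ioo (0 : ℝ) 1 → τ' ∈ Set.Ioo (0 : ℝ) 1 →
      TypicalStability.StableUnderComposition.{u, v} Ps k η τ ν
        (TypicalStability.etaStar k η τ τ')
        (TypicalStability.tauStar k η τ ν τ')
        (TypicalStability.tauStar k η τ ν τ')) ∧
    -- the orders of magnitude of the two correction terms
    (∃ C : ℝ, 0 < C ∧ ∀ η τ : ℝ, η ∈ Set.Ioc (0 : ℝ) (3 / 2) → τ ∈ Set.Ioc 0 (η / 50) →
      |TypicalStability.tauHat η τ| ≤ C * (τ / η) ∧
      |TypicalStability.psi η τ| ≤ C * (τ + τ ^ 2 / η ^ 2)) ∧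
    -- the asymptotic form
    (∀ C₁ C₂ : ℝ, 0 < C₁ → 0 < C₂ → ∃ C : ℝ, 0 < C ∧
      ∀ (X : Type u) [MeasurableSpace X] (n : ℕ) (Ps : Set (ProbabilityMeasure (Fin n → X)))
        (k : ℕ) (η τ ν τ' : ℝ), 2 ≤ k → η ∈ Set.Ioc (0 : ℝ) (3 / 2) → τ ∈ Set.Ioc 0 (η / 50) →
        ν ∈ Set.Ioo (0 : ℝ) 1 → τ' ∈ Set.Ioo (0 : ℝ) 1 →
        τ ≤ C₁ * η ^ 2 → η ≤ C₂ * Real.sqrt (Real.log (1 / τ') / k) →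
        TypicalStability.StableUnderComposition.{u, v} Ps k η τ ν
          (C * (Real.sqrt k * η * Real.sqrt (Real.log (1 / τ'))))
          (C * (Real.sqrt (k * (τ / η ^ 2 + τ' / η)) + Real.sqrt (k * ν / η) *
            Real.exp (C * (Real.sqrt k * η * Real.sqrt (Real.log (1 / τ'))))))
          (C * (Real.sqrt (k * (τ / η ^ 2 + τ' / η)) + Real.sqrt (k * ν / η) *
            Real.exp (C * (Real.sqrt k * η * Real.sqrt (Real.log (1 / τ'))))))) := by
  refine ⟨fun X _ n Ps k η τ ν τ' hk hη hτ hν hτ' =>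
    TypicalStability.stableUnderComposition_etaStar Ps hk hη hτ hν.1 hτ',
    ⟨5000, by norm_num, fun η τ hη hτ =>
      TypicalStability.abs_tauHat_le_and_abs_psi_le hη hτ.1.le⟩, fun C₁ C₂ hC₁ hC₂ => ?_⟩
  set K := 12 + 3 * (90 + 12 * C₁ + 5000 * (C₁ + C₁ ^ 2)) * C₂ with hK
  have hK0 : 0 < K := by positivity
  -- One constant must dominate both `K` from `etaStar_le`, also inside the exponential, and the
  -- `10` from `tauStar_le`.
  refine ⟨K + 10, by positivity, ?_⟩
  intro X _ n Ps k η τ ν τ' hk hη hτ hν hτ' hτC hηC Z _ _ A _ hA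
  have hη0 := hη.1
  have hstar : TypicalStability.etaStar k η τ τ' ≤
      (K + 10) * (Real.sqrt k * η * Real.sqrt (Real.log (1 / τ'))) := by
    refine (TypicalStability.etaStar_le hk hη hτ hC₁ hτC hηC).trans ?_
    exact mul_le_mul_of_nonneg_right (by linarith) (by positivity)
  have htau : TypicalStability.tauStar k η τ ν τ' ≤
      (K + 10) * (Real.sqrt (k * (τ / η ^ 2 + τ' / η)) + Real.sqrt (k * ν / η) *
        Real.exp ((K + 10) * (Real.sqrt k * η * Real.sqrt (Real.log (1 / τ'))))) := by
    refine (TypicalStability.tauStar_le hk hη hτ hν.1 hτ').trans ?_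
    gcongr
    linarith
  exact (TypicalStability.stableUnderComposition_etaStar.{u, v} Ps hk hη hτ hν.1 hτ' Z A hA).mono
    hstar htau htau
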